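/- Let $p:\mathbb R\to[1,\infty)$ be measurable with $p^+:=\operatorname{ess\,sup}_{x\in\mathbb R}p(x)<\infty$. Suppose that there are constants $c_1,c_2>0$ and $p_\infty>1$ with $$\left|\tfrac1{p(x)}-\tfrac1{p(y)}\right|\log\!\left(e+\tfrac1{|x-y|}\right)\le c_1\ (x\ne y),\qquad \left|\tfrac1{p(x)}-\tfrac1{p_\infty}\right|\log(e+|x|)\le c_2\ (x\in\mathbb R),$$ and put $c_3:=\max\{c_1,c_2\}$ (that is, $p\in P^{Log}(\mathbb R)$ with log-Hölder constant $c_3$). Let $L_{p(\cdot)}$ be the space of measurable $f:\mathbb R\to\mathbb R$ with $\int_{\mathbb R}|f(y)/\lambda|^{p(y)}dy<\infty$ for some $\lambda>0$, normed by $$\|f\|_{p(\cdot)}:=\inf\Big\{\eta>0:\int_{\mathbb R}|f(y)/\eta|^{p(y)}dy<1\Big\}.$$ For $r\in\{1,2,3,\dots\}$ let $W^r_{p(\cdot)}$ be the class of $g\in L_{p(\cdot)}$ whose derivatives $g^{(k)}$ exist for $k=1,\dots,r-1$, with $g^{(r-1)}$ absolutely continuous on every compact interval and $g^{(r)}\in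 L_{p(\cdot)}$. For $\delta>0$ and $f\in L_{p(\cdot)}$ put $$K_r(f,\delta,p(\cdot)):=\inf_{g\in W^r_{p(\cdot)}}\left\{\|f-g\|_{p(\cdot)}+\delta^r\|g^{(r)}\|_{p(\cdot)}\right\},\qquad \Omega_r(f,\delta)_{p(\cdot)}:=\|(I-T_\delta)^rf\|_{p(\cdot)},$$ where $T_\delta f(x):=\frac1\delta\int_0^\delta f(x+t)\,dt$. Put $$c_7:=2e^{8c_3},\qquad c_5:=2^{p^++1}3^{p^+}\Big(1+2\cdot3^{p^+}\Big[\sum_{k=2}^\infty2^{-k}+2\Big]\Big)e^{8c_3}.$$ Then, for every $r\ge1$, $\delta>0$ and $f\in L_{p(\cdot)}$, both quantities are finite and $$\Omega_r(f,\delta)_{p(\cdot)}\le 48\,c_7\,2^r\,c_5\;K_r(f,\delta,p(\cdot)),\qquad K_r(f,\delta,p(\cdot))\le 48\,c_7\left\{(2r)^r+2^r\,34^r\right\}c_5\;\Omega_r(f,\delta)_{p(\cdot)}.$$ -/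

import Mathlib

open MeasureTheory Filter
open scoped ENNReal

noncomputable section

namespace VarExp

/-- The modular `∫ |f y| ^ p(y) dy` on the real line, with values in `[0, ∞]`. -/
def modular (p f : ℝ → ℝ) : ℝ≥0∞ :=
  ∫⁻ y, ENNReal.ofReal (|f y| ^ p y)

/-- Membership in the variable exponent Lebesgue space: `f` is (Lebesgue) measurable and the modular
of `f / lam` is finite for some `lam > 0`. -/
def InLp (p f : ℝ → ℝ) : Prop :=
  AEMeasurable f ∧ ∃ lam : ℝ, 0 < lam ∧ modular p (fun y => f y / lam) < ∞

/-- The Luxemburg norm `inf {η > 0 : modular (f / η) < 1}`, with value `∞` when there is no such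
`η`. -/
def luxNorm (p f : ℝ → ℝ) : ℝ≥0∞ :=
  ⨅ (η : ℝ) (_ : 0 < η ∧ modular p (fun y => f y / η) < 1), ENNReal.ofReal η

/-- `p` is an exponent function of class `P^Log` on the real line, with local log-Hölder constant
`c₁` and decay constant `c₂`. Both log-Hölder conditions are imposed on `1 / p`. -/
structure IsPLog (p : ℝ → ℝ) (c₁ c₂ : ℝ) : Prop where
  measurable : Measurable p
  one_le : ∀ x, 1 ≤ p x
  /-- The essential supremum of `p` is finite. -/
  essBdd : ∃ M : ℝ, ∀ᵐ x, p x ≤ M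
  pos₁ : 0 < c₁
  pos₂ : 0 < c₂
  logHolder : ∀ x y, x ≠ y →
    |1 / p x - 1 / p y| * Real.log (Real.exp 1 + 1 / |x - y|) ≤ c₁
  logDecay : ∃ pInf : ℝ, 1 < pInf ∧ ∀ x,
    |1 / p x - 1 / pInf| * Real.log (Real.exp 1 + |x|) ≤ c₂

/-- The essential supremum `p⁺` of the exponent. -/
def pPlus (p : ℝ → ℝ) : ℝ := essSup p volume

/-- The constant `c₅(p⁺, c₃)`. -/
def c5 (pp c : ℝ) : ℝ :=
  (2 : ℝ) ^ (pp + 1) * (3 : ℝ) ^ pp *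
    (1 + 2 * (3 : ℝ) ^ pp * ((∑' k : ℕ, (1 / 2 : ℝ) ^ (k + 2)) + 2)) * Real.exp (8 * c)

/-- The constant `c₇(c₃)`. -/
def c7 (c : ℝ) : ℝ := 2 * Real.exp (8 * c)

/-- The forward Steklov operator `T_δ f(x) = (1/δ) ∫₀^δ f(x + t) dt`. -/
def steklov (δ : ℝ) (f : ℝ → ℝ) : ℝ → ℝ :=
  fun x => (1 / δ) * ∫ t in (0 : ℝ)..δ, f (x + t)

/-- The operator power `(I - T_δ)^r f`. -/
def steklovDiff (r : ℕ) (δ : ℝ) (f : ℝ → ℝ) : ℝ → ℝ :=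
  (fun g : ℝ → ℝ => fun x => g x - steklov δ g x)^[r] f

/-- The modulus of smoothness `Ω_r(f, δ)_{p(·)} = ‖(I - T_δ)^r f‖_{p(·)}`. -/
def modulus (p : ℝ → ℝ) (r : ℕ) (f : ℝ → ℝ) (δ : ℝ) : ℝ≥0∞ :=
  luxNorm p (steklovDiff r δ f)

/-- The Sobolev class `W^r_{p(·)}` (`r ≥ 1`): `g ∈ L_{p(·)}`, the derivatives of `g` of orders
`1, …, r - 1` exist everywhere, `g^{(r-1)}` is absolutely continuous on every compact interval, and
its almost everywhere defined derivative `g^{(r)}` lies in `L_{p(·)}`. -/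
structure InSobolev (p : ℝ → ℝ) (r : ℕ) (g : ℝ → ℝ) : Prop where
  memLp : InLp p g
  differentiable : ∀ k : ℕ, k + 1 < r → Differentiable ℝ (iteratedDeriv k g)
  absCont : ∀ a b : ℝ, AbsolutelyContinuousOnInterval (iteratedDeriv (r - 1) g) a b
  memLp_deriv : InLp p (iteratedDeriv r g)

/-- Peetre's K-functional of the pair `L_{p(·)}`, `W^r_{p(·)}`. -/
def kFunctional (p : ℝ → ℝ) (r : ℕ) (f : ℝ → ℝ) (δ : ℝ) : ℝ≥0∞ :=
  ⨅ (g : ℝ → ℝ) (_ : InSobolev p r g),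
    luxNorm p (fun x => f x - g x) + ENNReal.ofReal (δ ^ r) * luxNorm p (iteratedDeriv r g)

end VarExp

end

noncomputable section

namespace VarExp

/-! ### Modulars and the Luxemburg norm -/

section Luxemburg

variable {p f g : ℝ → ℝ}

/-! Write T for the average over `[x, x + δ]`, S for the shift by `δ`, and A_n for the average
against `(1 - t/δ)^n / n!`, so A_0 = T. The proof is algebra with these operators on locally
integrable functions, plus one analytic fact: averages over intervals of every length are bounded on
the variable exponent space by a single constant D = 20 e^{4c} with c = `max c₁ c₂`
(`IsPLog.luxNorm_steklov_abs_le`).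

Applying that fact once per factor would cost D^r. Instead an operator L is measured by its local L¹
mass M and its reach of k steps (`OpBound`), both of which behave well under sums and products. One
averaging factor in front of L makes the result pointwise at most M(k+1) times one average over
length `(k + 1) * δ`, so D is paid once (`IsPLog.luxNorm_avgOp_mul_le`).

Upper bound for the modulus: split f = (f - g) + g. On f - g use (1-T)^r = 1 - T ∑_{k<r} (1-T)^k.
The trivial mass 2^k of (1-T)^k is improved to order (7/4)^k, because (1-T)² has mass at most 3;
this leaves room for the reach factor inside 2^r. On g, integration by parts gives (1-T)g = -δ A_1
g', hence (1-T)^r g = (-δ)^r A_1^r g^{(r)}, and A_1 has mass 1/2.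

Upper bound for the K-functional: take g = (1 - (1-T^{r+1})^r) f. The error f - g is P^r (1-T)^r f
with P = 1 + T + ... + T^r. Moreover g = T^r w with w = T applied to a polynomial in T of f, so
g^{(r)} = δ^{-r} (S-1)^r w, and it remains to control (S-1)^r by (1-T)^r. Formally S-1 is divided by
1-T through S-1 = (S-1-2T²)(1-T) + Q(S-1), where Q = T - 2A_1T = -2A_2(S-1) has mass at most 2/3.
Iterating gives a Neumann series. Since the reach of Q^n grows with n, masses are weighted by
(21/20)^{reach}, under which Q is still a contraction; the remainder disappears in the limit because
f has finite norm. -/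

theorem modular_mono (hp : ∀ x, 0 ≤ p x) (h : ∀ᵐ x, |f x| ≤ |g x|) :
    modular p f ≤ modular p g := by
  refine lintegral_mono_ae ?_
  filter_upwards [h] with x hx
  exact ENNReal.ofReal_le_ofReal (Real.rpow_le_rpow (abs_nonneg _) hx (hp x))

theorem luxNorm_le_ofReal {η : ℝ} (hη : 0 < η) (h : modular p (fun y => f y / η) < 1) :
    luxNorm p f ≤ ENNReal.ofReal η :=
  iInf₂_le η ⟨hη, h⟩

theorem luxNorm_mono (hp : ∀ x, 0 ≤ p x) (h : ∀ᵐ x, |f x| ≤ |g x|) :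
    luxNorm p f ≤ luxNorm p g := by
  refine le_iInf₂ fun η hη => luxNorm_le_ofReal hη.1 ((modular_mono hp ?_).trans_lt hη.2)
  filter_upwards [h] with x hx
  rw [abs_div, abs_div]
  gcongr

theorem modular_div_le (hp : ∀ x, 1 ≤ p x) {K : ℝ} (hK : 1 ≤ K) (f : ℝ → ℝ) :
    modular p (fun y => f y / K) ≤ ENNReal.ofReal K⁻¹ * modular p f := by
  have hK0 : 0 < K := by linarith
  rw [modular, modular, ← lintegral_const_mul' _ _ ENNReal.ofReal_ne_top]
  refine lintegral_mono fun y => ?_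
  rw [← ENNReal.ofReal_mul (by positivity)]
  refine ENNReal.ofReal_le_ofReal ?_
  rw [abs_div, abs_of_pos hK0, div_eq_inv_mul, Real.mul_rpow (by positivity) (abs_nonneg _)]
  refine mul_le_mul_of_nonneg_right ?_ (by positivity)
  calc K⁻¹ ^ p y ≤ K⁻¹ ^ (1 : ℝ) :=
        Real.rpow_le_rpow_of_exponent_ge (by positivity) (inv_le_one_of_one_le₀ hK) (hp y)
    _ = K⁻¹ := Real.rpow_one _

theorem modular_convex_comb_le (hpm : Measurable p) (hp : ∀ x, 1 ≤ p x)
    (hf : AEMeasurable f) {a b : ℝ} (ha : 0 ≤ a) (hb : 0 ≤ b) (hab : a + b = 1) :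
    modular p (fun y => a * f y + b * g y) ≤
      ENNReal.ofReal a * modular p f + ENNReal.ofReal b * modular p g := by
  have hm : AEMeasurable fun y => ENNReal.ofReal a * ENNReal.ofReal (|f y| ^ p y) := by
    have : AEMeasurable fun y => |f y| ^ p y := by fun_prop
    fun_prop
  rw [modular, modular, modular, ← lintegral_const_mul' _ _ ENNReal.ofReal_ne_top,
    ← lintegral_const_mul' _ _ ENNReal.ofReal_ne_top, ← lintegral_add_left' hm]
  refine lintegral_mono fun y => ?_
  rw [← ENNReal.ofReal_mul ha, ← ENNReal.ofReal_mul hb,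
    ← ENNReal.ofReal_add (by positivity) (by positivity)]
  refine ENNReal.ofReal_le_ofReal ?_
  have h1 : |a * f y + b * g y| ≤ a * |f y| + b * |g y| := by
    refine (abs_add_le _ _).trans ?_
    rw [abs_mul, abs_mul, abs_of_nonneg ha, abs_of_nonneg hb]
  exact (Real.rpow_le_rpow (abs_nonneg _) h1 (by linarith [hp y])).trans
    ((convexOn_rpow (hp y)).2 (abs_nonneg (f y)) (abs_nonneg (g y)) ha hb hab)

theorem luxNorm_add_le (hpm : Measurable p) (hp : ∀ x, 1 ≤ p x) (hf : AEMeasurable f) :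
    luxNorm p (fun x => f x + g x) ≤ luxNorm p f + luxNorm p g := by
  have key : ∀ a b : ℝ, (0 < a ∧ modular p (fun y => f y / a) < 1) →
      (0 < b ∧ modular p (fun y => g y / b) < 1) →
      luxNorm p (fun x => f x + g x) ≤ ENNReal.ofReal a + ENNReal.ofReal b := by
    rintro a b ⟨ha, hfa⟩ ⟨hb, hgb⟩
    rw [← ENNReal.ofReal_add ha.le hb.le]
    refine luxNorm_le_ofReal (by positivity) ?_
    have e : (fun y => (f y + g y) / (a + b)) =
        fun y => a / (a + b) * (f y / a) + b / (a + b) * (g y / b) := by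
      funext y; field_simp
    rw [e]
    refine (modular_convex_comb_le hpm hp (hf.div_const a) (by positivity) (by positivity)
      (by field_simp)).trans_lt ?_
    calc _ < ENNReal.ofReal (a / (a + b)) * 1 + ENNReal.ofReal (b / (a + b)) * 1 := by
          refine ENNReal.add_lt_add ?_ ?_
          · exact (ENNReal.mul_lt_mul_iff_right (by simp; positivity) ENNReal.ofReal_ne_top).2 hfa
          · exact (ENNReal.mul_lt_mul_iff_right (by simp; positivity) ENNReal.ofReal_ne_top).2 hgb
      _ = 1 := by
          rw [mul_one, mul_one, ← ENNReal.ofReal_add (by positivity) (by positivity), ← add_div,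
            div_self (by positivity), ENNReal.ofReal_one]
  rw [luxNorm.eq_def p f, luxNorm.eq_def p g]
  simp_rw [ENNReal.iInf_add, ENNReal.add_iInf]
  exact le_iInf₂ fun a ha => le_iInf₂ fun b hb => key a b ha hb

theorem luxNorm_const_mul_le (hp : ∀ x, 1 ≤ p x) (c : ℝ) (f : ℝ → ℝ) :
    luxNorm p (fun x => c * f x) ≤ ENNReal.ofReal |c| * luxNorm p f := by
  rcases eq_or_ne c 0 with rfl | hc
  -- The norm of `f` may be infinite, and then `0 * ∞ = 0`: the zero function must be shown directly
  -- to have norm zero.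
  · simp only [zero_mul, abs_zero, ENNReal.ofReal_zero]
    refine le_of_forall_gt fun a ha => ?_
    obtain ⟨b, hb0, hba⟩ := ENNReal.lt_iff_exists_real_btwn.1 ha
    refine lt_of_le_of_lt (luxNorm_le_ofReal (η := b) (ENNReal.ofReal_pos.1 hba.1) ?_) hba.2
    have : ∀ y, (0 : ℝ) ^ p y = 0 := fun y => Real.zero_rpow (by linarith [hp y])
    simp [modular, this]
  · have hc' : 0 < |c| := abs_pos.2 hc
    rw [luxNorm.eq_def p f, ENNReal.mul_iInf_of_ne (by simpa using hc) ENNReal.ofReal_ne_top]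
    refine le_iInf fun η => ?_
    rw [ENNReal.mul_iInf_of_ne (by simpa using hc) ENNReal.ofReal_ne_top]
    refine le_iInf fun hη => ?_
    rw [← ENNReal.ofReal_mul (abs_nonneg _)]
    refine luxNorm_le_ofReal (by have := hη.1; positivity)
      ((modular_mono (fun x => by linarith [hp x]) (ae_of_all _ fun x => ?_)).trans_lt hη.2)
    have := hη.1
    rw [abs_div, abs_div, abs_mul, abs_mul, abs_abs, mul_div_mul_left _ _ hc'.ne']

theorem inLp_iff (hp : ∀ x, 1 ≤ p x) : InLp p f ↔ AEMeasurable f ∧ luxNorm p f < ∞ := by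
  refine and_congr_right fun hf => ⟨?_, ?_⟩
  · rintro ⟨lam, hlam, h⟩
    set m := (modular p fun y => f y / lam).toReal with hm
    have hm0 : 0 ≤ m := ENNReal.toReal_nonneg
    -- A further division by `m + 1` brings the modular down from `m` to at most `m / (m + 1) < 1`,
    -- because the exponent is at least one.
    refine (luxNorm_le_ofReal (η := lam * (m + 1)) (by positivity) ?_).trans_lt
      ENNReal.ofReal_lt_top
    have e : (fun y => f y / (lam * (m + 1))) = fun y => f y / lam / (m + 1) := by
      funext y; rw [div_div]
    rw [e]
    refine (modular_div_le hp (by linarith) _).trans_lt ?_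
    rw [← ENNReal.ofReal_toReal h.ne, ← ENNReal.ofReal_mul (by positivity), ← hm,
      ENNReal.ofReal_lt_one, inv_mul_lt_iff₀ (by positivity)]
    linarith
  · intro h
    obtain ⟨η, h⟩ := iInf_lt_iff.1 h
    obtain ⟨hη, -⟩ := iInf_lt_iff.1 h
    exact ⟨η, hη.1, hη.2.trans ENNReal.one_lt_top⟩

/-- An exponent at least one gives |s| ≤ 1 + |s|^p, and the right side is locally integrable. Hence
all operators may be studied on locally integrable functions. -/
theorem InLp.locallyIntegrable (hpm : Measurable p) (hp : ∀ x, 1 ≤ p x) (hf : InLp p f) :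
    LocallyIntegrable f := by
  obtain ⟨hfm, lam, hlam, h⟩ := hf
  have hm : AEMeasurable fun y => |f y / lam| ^ p y := by fun_prop
  have hi : Integrable fun y => |f y / lam| ^ p y := by
    refine ⟨hm.aestronglyMeasurable, ?_⟩
    rw [hasFiniteIntegral_iff_ofReal (ae_of_all _ fun y => by positivity)]
    exact h
  have hl : LocallyIntegrable fun y => lam * (1 + |f y / lam| ^ p y) := by
    have h1 : LocallyIntegrable fun y => (1 : ℝ) + |f y / lam| ^ p y :=
      (continuous_const.locallyIntegrable).add hi.locallyIntegrable
    exact h1.smul lam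
  refine hl.mono hfm.aestronglyMeasurable (ae_of_all _ fun y => ?_)
  have h0 : 0 ≤ |f y / lam| ^ p y := by positivity
  rw [Real.norm_eq_abs, Real.norm_of_nonneg (by positivity)]
  have h1 : |f y / lam| ≤ 1 + |f y / lam| ^ p y := by
    rcases le_total |f y / lam| 1 with h | h
    · linarith
    · have := Real.rpow_le_rpow_of_exponent_le h (hp y)
      rw [Real.rpow_one] at this
      linarith
  rw [abs_div, abs_of_pos hlam, div_le_iff₀ hlam] at h1
  rw [abs_div, abs_of_pos hlam]
  linarith

end Luxemburg

/-! ### Tonelli's theorem for translates -/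

section Tonelli

theorem lintegral_lintegral_translate_le {G φ : ℝ → ℝ≥0∞} (hG : AEMeasurable G)
    (hφ : Measurable φ) {s s' I : Set ℝ} (h : ∀ y ∈ s, ∀ t ∈ I, y + t ∈ s')
    (hs : MeasurableSet s) (hs' : MeasurableSet s') (hI : MeasurableSet I) :
    ∫⁻ y in s, ∫⁻ t in I, φ t * G (y + t) ≤ (∫⁻ t in I, φ t) * ∫⁻ y in s', G y := by
  have e : ∀ y, ∫⁻ t in I, φ t * G (y + t) = ∫⁻ t in I, φ t * hG.mk G (y + t) := fun y => by
    refine lintegral_congr_ae (ae_restrict_of_ae ?_)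
    have := (measurePreserving_add_left volume y).quasiMeasurePreserving.ae_eq_comp hG.ae_eq_mk
    filter_upwards [this] with t ht
    simp only [Function.comp_apply] at ht
    rw [ht]
  have e' : ∫⁻ y in s', G y = ∫⁻ y in s', hG.mk G y :=
    lintegral_congr_ae (ae_restrict_of_ae hG.ae_eq_mk)
  simp_rw [e, e']
  have hm := hG.measurable_mk
  rw [lintegral_lintegral_swap (by fun_prop), ← lintegral_mul_const _ hφ]
  refine setLIntegral_mono' hI fun t ht => ?_
  rw [lintegral_const_mul _ (by fun_prop)]
  refine mul_le_mul' le_rfl ?_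
  rw [← lintegral_indicator hs, ← lintegral_indicator hs',
    ← lintegral_add_right_eq_self (s'.indicator (hG.mk G)) t]
  refine lintegral_mono fun y => ?_
  by_cases hy : y ∈ s
  · simp [hy, h y hy t ht]
  · simp [hy]

end Tonelli

/-! ### Uniform boundedness of one-sided averages -/

section Averaging

/-- The integrable weight that absorbs the oscillation of the exponent at infinity. -/
def decayWeight (x : ℝ) : ℝ := ((Real.exp 1 + |x|) ^ 2)⁻¹

theorem exp_one_add_abs_pos (x : ℝ) : 0 < Real.exp 1 + |x| := by positivity

theorem decayWeight_pos (x : ℝ) : 0 < decayWeight x := by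
  have := exp_one_add_abs_pos x
  unfold decayWeight; positivity

theorem decayWeight_le_inv (x : ℝ) : decayWeight x ≤ (1 + x ^ 2)⁻¹ := by
  unfold decayWeight
  have h1 : (1 : ℝ) ≤ Real.exp 1 := Real.one_le_exp (by norm_num)
  refine inv_anti₀ (by positivity) ?_
  have := abs_nonneg x
  nlinarith [sq_abs x]

theorem decayWeight_le_one (x : ℝ) : decayWeight x ≤ 1 :=
  (decayWeight_le_inv x).trans (inv_le_one_of_one_le₀ (by nlinarith [sq_nonneg x]))

theorem continuous_decayWeight : Continuous decayWeight := by
  unfold decayWeight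
  refine Continuous.inv₀ (by fun_prop) fun x => ?_
  have := exp_one_add_abs_pos x
  positivity

theorem log_decayWeight (x : ℝ) :
    Real.log (decayWeight x) = -(2 * Real.log (Real.exp 1 + |x|)) := by
  unfold decayWeight
  rw [Real.log_inv, Real.log_pow]; norm_num

theorem lintegral_decayWeight_le : ∫⁻ x, ENNReal.ofReal (decayWeight x) ≤ ENNReal.ofReal 4 := by
  calc ∫⁻ x, ENNReal.ofReal (decayWeight x) ≤ ∫⁻ x : ℝ, ENNReal.ofReal ((1 + x ^ 2)⁻¹) :=
        lintegral_mono fun x => ENNReal.ofReal_le_ofReal (decayWeight_le_inv x)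
    _ = ENNReal.ofReal (∫ x : ℝ, (1 + x ^ 2)⁻¹) :=
        (ofReal_integral_eq_lintegral_ofReal integrable_inv_one_add_sq
          (ae_of_all _ fun x => by positivity)).symm
    _ ≤ _ := by
        rw [integral_univ_inv_one_add_sq]
        exact ENNReal.ofReal_le_ofReal (by linarith [Real.pi_le_four])

theorem rpow_le_exp_of_abs_mul_log_le {z D K : ℝ} (hz : 0 < z) (h : |D| * |Real.log z| ≤ K) :
    z ^ D ≤ Real.exp K := by
  rw [Real.rpow_def_of_pos hz]
  refine Real.exp_le_exp.2 (le_trans (le_abs_self _) ?_)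
  rwa [abs_mul, mul_comm]

/-- If the powers `z ^ (1 / Q - 1 / P)` are bounded by `C` for the relevant `z`, the exponent `Q`
may be traded for `P`. -/
theorem rpow_inv_le_of_exponent_bound {P Q A Φ C : ℝ} (hP : 1 ≤ P) (hQ : 1 ≤ Q) (hA : 0 < A)
    (hΦ : 0 < Φ) (hC : 1 ≤ C)
    (h1 : 1 ≤ A → A ^ (1 / Q - 1 / P) ≤ C)
    (h2 : ∀ z, z ≤ 1 → A ≤ z → Φ ≤ z → z ^ (1 / Q - 1 / P) ≤ C) :
    Φ ^ (1 / Q) ≤ C * A ^ (1 / P) * (1 + Φ / A) := by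
  have hP0 : 0 < P := by linarith
  have hQ0 : 0 < Q := by linarith
  have hQ1 : 1 / Q ≤ 1 := by rw [div_le_one hQ0]; exact hQ
  have hP1 : 1 / P ≤ 1 := by rw [div_le_one hP0]; exact hP
  have split : ∀ z : ℝ, 0 < z → z ^ (1 / Q) = z ^ (1 / Q - 1 / P) * z ^ (1 / P) := fun z hz => by
    rw [← Real.rpow_add hz]; congr 1; ring
  have hAP : 0 < A ^ (1 / P) := by positivity
  have hr : 0 < Φ / A := by positivity
  -- Four cases. For A ≥ 1, bound Φ by A(1 + Φ/A) and trade exponents at z = A by `h1`. For A < 1,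
  -- trade by `h2` at z = A if Φ ≤ A, and at z = Φ if A < Φ ≤ 1. For A < 1 < Φ no trade is needed,
  -- since Φ^(1/Q) ≤ Φ = A(Φ/A) and A ≤ A^(1/P).
  rcases le_or_gt 1 A with hA1 | hA1
  · calc Φ ^ (1 / Q) ≤ (A * (1 + Φ / A)) ^ (1 / Q) := by
          refine Real.rpow_le_rpow hΦ.le ?_ (by positivity)
          field_simp; linarith
      _ = A ^ (1 / Q) * (1 + Φ / A) ^ (1 / Q) := Real.mul_rpow hA.le (by positivity)
      _ ≤ (C * A ^ (1 / P)) * (1 + Φ / A) := by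
          refine mul_le_mul ?_ ?_ (by positivity) (by positivity)
          · rw [split A hA]
            gcongr
            exact h1 hA1
          · calc (1 + Φ / A) ^ (1 / Q) ≤ (1 + Φ / A) ^ (1 : ℝ) :=
                  Real.rpow_le_rpow_of_exponent_le (by linarith) hQ1
              _ = _ := Real.rpow_one _
  · rcases le_or_gt Φ A with hΦA | hΦA
    · calc Φ ^ (1 / Q) ≤ A ^ (1 / Q) := Real.rpow_le_rpow hΦ.le hΦA (by positivity)
        _ ≤ C * A ^ (1 / P) := by
            rw [split A hA]
            gcongr
            exact h2 A hA1.le le_rfl hΦA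
        _ ≤ _ := le_mul_of_one_le_right (by positivity) (by linarith)
    · rcases le_or_gt Φ 1 with hΦ1 | hΦ1
      · calc Φ ^ (1 / Q) ≤ C * Φ ^ (1 / P) := by
              rw [split Φ hΦ]
              gcongr
              exact h2 Φ hΦ1 hΦA.le le_rfl
          _ = C * (A ^ (1 / P) * (Φ / A) ^ (1 / P)) := by
              rw [← Real.mul_rpow hA.le hr.le]; congr 2; field_simp
          _ ≤ C * (A ^ (1 / P) * (1 + Φ / A)) := by
              gcongr
              calc (Φ / A) ^ (1 / P) ≤ (1 + Φ / A) ^ (1 / P) :=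
                    Real.rpow_le_rpow hr.le (by linarith) (by positivity)
                _ ≤ (1 + Φ / A) ^ (1 : ℝ) :=
                    Real.rpow_le_rpow_of_exponent_le (by linarith) hP1
                _ = _ := Real.rpow_one _
          _ = _ := by ring
      · have hA' : A ≤ A ^ (1 / P) := by
          calc A = A ^ (1 : ℝ) := (Real.rpow_one _).symm
            _ ≤ _ := Real.rpow_le_rpow_of_exponent_ge hA hA1.le hP1
        calc Φ ^ (1 / Q) ≤ Φ ^ (1 : ℝ) := Real.rpow_le_rpow_of_exponent_le hΦ1.le hQ1
          _ = 1 * A * (Φ / A) := by rw [Real.rpow_one]; field_simp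
          _ ≤ C * A ^ (1 / P) * (1 + Φ / A) := by
            gcongr
            linarith

variable {p : ℝ → ℝ} {c₁ c₂ : ℝ}

/-- Within distance `δ` the logarithm of z is at most twice the logarithm in the local condition, so
the power is at most e^{2c₁}. -/
theorem IsPLog.local_exponent_bound (hp : IsPLog p c₁ c₂) {δ x y z : ℝ} (hδ : 0 < δ)
    (hxy : |x - y| ≤ δ) (hz1 : 1 ≤ z) (hz : z ≤ (Real.exp 1 + 1 / δ) ^ 2) :
    z ^ (1 / p y - 1 / p x) ≤ Real.exp (4 * max c₁ c₂) := by
  have hc : c₁ ≤ max c₁ c₂ := le_max_left _ _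
  have hc0 := hp.pos₁
  refine rpow_le_exp_of_abs_mul_log_le (by linarith) ?_
  rcases eq_or_ne x y with rfl | hne
  · simp only [sub_self, abs_zero, zero_mul]; linarith
  · have hd : 0 < |x - y| := abs_pos.2 (sub_ne_zero.2 hne)
    have h0 : 0 < Real.exp 1 + 1 / δ := by positivity
    have h1 : Real.log z ≤ 2 * Real.log (Real.exp 1 + 1 / |x - y|) := by
      calc Real.log z ≤ Real.log ((Real.exp 1 + 1 / δ) ^ 2) := Real.log_le_log (by linarith) hz
        _ = 2 * Real.log (Real.exp 1 + 1 / δ) := by rw [Real.log_pow]; norm_num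
        _ ≤ _ := by gcongr
    have h2 := hp.logHolder x y hne
    rw [abs_of_nonneg (Real.log_nonneg hz1), abs_sub_comm]
    calc _ ≤ |1 / p x - 1 / p y| * (2 * Real.log (Real.exp 1 + 1 / |x - y|)) := by gcongr
      _ ≤ 2 * c₁ := by linarith
      _ ≤ _ := by linarith

/-- A number z above the weight at u satisfies -log z ≤ 2 log(e + |u|). Comparing both exponents
with the limit exponent costs 2c₂ at each of the two points. -/
theorem IsPLog.decay_exponent_bound (hp : IsPLog p c₁ c₂) {x y z : ℝ} (hz1 : z ≤ 1)
    (hx : decayWeight x ≤ z) (hy : decayWeight y ≤ z) :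
    z ^ (1 / p y - 1 / p x) ≤ Real.exp (4 * max c₁ c₂) := by
  have hc : c₂ ≤ max c₁ c₂ := le_max_right _ _
  have hz0 : 0 < z := (decayWeight_pos x).trans_le hx
  refine rpow_le_exp_of_abs_mul_log_le hz0 ?_
  obtain ⟨q, -, hq⟩ := hp.logDecay
  rw [abs_of_nonpos (Real.log_nonpos hz0.le hz1)]
  have h : ∀ u, decayWeight u ≤ z → -Real.log z ≤ 2 * Real.log (Real.exp 1 + |u|) := fun u hu => by
    have := Real.log_le_log (decayWeight_pos u) hu
    rw [log_decayWeight] at this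
    linarith
  have hl : 0 ≤ -Real.log z := by linarith [Real.log_nonpos hz0.le hz1]
  have h3 : |1 / p y - 1 / p x| ≤ |1 / p y - 1 / q| + |1 / p x - 1 / q| := by
    calc _ = |(1 / p y - 1 / q) - (1 / p x - 1 / q)| := by congr 1; ring
      _ ≤ _ := abs_sub _ _
  calc _ ≤ (|1 / p y - 1 / q| + |1 / p x - 1 / q|) * -Real.log z := by gcongr
    _ = |1 / p y - 1 / q| * -Real.log z + |1 / p x - 1 / q| * -Real.log z := by ring
    _ ≤ |1 / p y - 1 / q| * (2 * Real.log (Real.exp 1 + |y|)) +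
        |1 / p x - 1 / q| * (2 * Real.log (Real.exp 1 + |x|)) := by
      gcongr
      · exact h y hy
      · exact h x hx
    _ ≤ 4 * c₂ := by linarith [hq x, hq y]
    _ ≤ _ := by linarith

theorem intervalIntegrable_translate {u : ℝ → ℝ} (hu : LocallyIntegrable u) (x a b : ℝ) :
    IntervalIntegrable (fun t => u (x + t)) volume a b := by
  have h : IntervalIntegrable u volume (x + a) (x + b) :=
    (hu.integrableOn_isCompact isCompact_uIcc).intervalIntegrable
  simpa using h.comp_add_left x

theorem ofReal_intervalIntegral_eq {u : ℝ → ℝ} {δ : ℝ} (hδ : 0 ≤ δ) (hu0 : ∀ t, 0 ≤ u t)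
    (hu : IntervalIntegrable u volume 0 δ) :
    ENNReal.ofReal (∫ t in (0 : ℝ)..δ, u t) = ∫⁻ t in Set.Ioc 0 δ, ENNReal.ofReal (u t) := by
  rw [intervalIntegral.integral_of_le hδ]
  exact ofReal_integral_eq_lintegral_ofReal ((intervalIntegrable_iff_integrableOn_Ioc_of_le hδ).1 hu)
    (ae_of_all _ hu0)

theorem lintegral_steklov_le {u : ℝ → ℝ} {δ : ℝ} (hδ : 0 < δ) (hu0 : ∀ t, 0 ≤ u t)
    (hu : LocallyIntegrable u) :
    ∫⁻ x, ENNReal.ofReal (steklov δ u x) ≤ ∫⁻ x, ENNReal.ofReal (u x) := by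
  have e : ∀ x, ENNReal.ofReal (steklov δ u x) =
      ∫⁻ t in Set.Ioc 0 δ, ENNReal.ofReal (1 / δ) * ENNReal.ofReal (u (x + t)) := fun x => by
    rw [steklov, ENNReal.ofReal_mul (by positivity), lintegral_const_mul' _ _ ENNReal.ofReal_ne_top,
      ofReal_intervalIntegral_eq hδ.le (fun t => hu0 _) (intervalIntegrable_translate hu x 0 δ)]
  simp_rw [e]
  have := lintegral_lintegral_translate_le (s := Set.univ) (s' := Set.univ) (I := Set.Ioc 0 δ)
    (hu.aestronglyMeasurable.aemeasurable.ennreal_ofReal)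
    (measurable_const (a := ENNReal.ofReal (1 / δ))) (by simp) MeasurableSet.univ MeasurableSet.univ
    measurableSet_Ioc
  simp only [Measure.restrict_univ] at this
  refine this.trans (le_of_eq ?_)
  rw [lintegral_const, Measure.restrict_apply_univ, Real.volume_Ioc, sub_zero,
    ← ENNReal.ofReal_mul (by positivity), one_div, inv_mul_cancel₀ hδ.ne', ENNReal.ofReal_one,
    one_mul]

theorem locallyIntegrable_abs {u : ℝ → ℝ} (hu : LocallyIntegrable u) :
    LocallyIntegrable fun y => |u y| :=
  hu.mono hu.aestronglyMeasurable.norm (ae_of_all _ fun y => by simp)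

theorem steklov_eq_primitive {u : ℝ → ℝ} (hu : LocallyIntegrable u) (δ x : ℝ) :
    steklov δ u x = (1 / δ) * ((∫ t in (0 : ℝ)..(x + δ), u t) - ∫ t in (0 : ℝ)..x, u t) := by
  have hi : ∀ a b, IntervalIntegrable u volume a b := fun a b =>
    (hu.integrableOn_isCompact isCompact_uIcc).intervalIntegrable
  rw [steklov, intervalIntegral.integral_comp_add_left, add_zero,
    intervalIntegral.integral_interval_sub_left (hi _ _) (hi _ _)]

theorem continuous_steklov {u : ℝ → ℝ} (hu : LocallyIntegrable u) (δ : ℝ) :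
    Continuous (steklov δ u) := by
  have hi : ∀ a b, IntervalIntegrable u volume a b := fun a b =>
    (hu.integrableOn_isCompact isCompact_uIcc).intervalIntegrable
  have hc := intervalIntegral.continuous_primitive hi 0
  have : steklov δ u = fun x =>
      (1 / δ) * ((∫ t in (0 : ℝ)..(x + δ), u t) - ∫ t in (0 : ℝ)..x, u t) :=
    funext (steklov_eq_primitive hu δ)
  rw [this]
  exact continuous_const.mul ((hc.comp (continuous_id.add continuous_const)).sub hc)

theorem steklov_nonneg {u : ℝ → ℝ} {δ : ℝ} (hδ : 0 < δ) (hu : ∀ t, 0 ≤ u t) (x : ℝ) :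
    0 ≤ steklov δ u x :=
  mul_nonneg (by positivity) (intervalIntegral.integral_nonneg hδ.le fun t _ => hu _)

theorem steklov_mono {u v : ℝ → ℝ} {δ x : ℝ} (hδ : 0 < δ) (hu : LocallyIntegrable u)
    (hv : LocallyIntegrable v) (h : ∀ t ∈ Set.Icc 0 δ, u (x + t) ≤ v (x + t)) :
    steklov δ u x ≤ steklov δ v x :=
  mul_le_mul_of_nonneg_left (intervalIntegral.integral_mono_on hδ.le
    (intervalIntegrable_translate hu x 0 δ) (intervalIntegrable_translate hv x 0 δ) h)
    (by positivity)

/-- Averages over `[x, x + δ]` obey a pointwise Jensen-type inequality up to an integrable error. -/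
theorem IsPLog.steklov_rpow_le (hp : IsPLog p c₁ c₂) {f : ℝ → ℝ} (hfl : LocallyIntegrable f)
    (hfi : Integrable fun y => |f y| ^ p y) (hf1 : ∫ y, |f y| ^ p y ≤ 1) {δ : ℝ} (hδ : 0 < δ)
    (x : ℝ) :
    (steklov δ (fun y => |f y|) x / (2 * Real.exp (4 * max c₁ c₂))) ^ p x ≤
      steklov δ (fun y => |f y| ^ p y + decayWeight y) x + decayWeight x := by
  set C := Real.exp (4 * max c₁ c₂) with hCdef
  have hC1 : 1 ≤ C := Real.one_le_exp (by
    have := hp.pos₁.le.trans (le_max_left c₁ c₂); positivity)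
  set Φ : ℝ → ℝ := fun y => |f y| ^ p y + decayWeight y with hΦ
  have hwl : LocallyIntegrable decayWeight := continuous_decayWeight.locallyIntegrable
  have hΦl : LocallyIntegrable Φ := hfi.locallyIntegrable.add hwl
  have hΦ0 : ∀ y, 0 < Φ y := fun y => by
    have h1 := decayWeight_pos y
    have : 0 ≤ |f y| ^ p y := by positivity
    simp only [hΦ]; linarith
  have hm0 : 0 ≤ steklov δ Φ x := steklov_nonneg hδ (fun t => (hΦ0 t).le) x
  -- Adding the weight here and in `Φ` keeps `A` above the weight at `x` and `Φ` above it pointwise,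
  -- which is what the decay bound asks of z.
  set A := steklov δ Φ x + decayWeight x with hA
  have hwx := decayWeight_pos x
  have hA0 : 0 < A := by linarith
  have hmA : steklov δ Φ x ≤ A := by linarith
  -- This puts `A` in the range of the local bound: the modular contributes at most 1/δ to the
  -- average, the two weights at most 1 each.
  have hAle : A ≤ (Real.exp 1 + 1 / δ) ^ 2 := by
    have h1 : steklov δ Φ x ≤ 1 / δ + 1 := by
      have e1 : ∫ t in (0 : ℝ)..δ, Φ (x + t) =
          (∫ t in (0 : ℝ)..δ, |f (x + t)| ^ p (x + t)) + ∫ t in (0 : ℝ)..δ, decayWeight (x + t) :=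
        intervalIntegral.integral_add (intervalIntegrable_translate hfi.locallyIntegrable x 0 δ)
          (intervalIntegrable_translate hwl x 0 δ)
      have e2 : ∫ t in (0 : ℝ)..δ, |f (x + t)| ^ p (x + t) ≤ 1 := by
        refine le_trans ?_ hf1
        rw [intervalIntegral.integral_comp_add_left (fun y => |f y| ^ p y),
          intervalIntegral.integral_of_le (by linarith)]
        exact setIntegral_le_integral hfi (ae_of_all _ fun y => by positivity)
      have e3 : ∫ t in (0 : ℝ)..δ, decayWeight (x + t) ≤ δ := by
        calc _ ≤ ∫ t in (0 : ℝ)..δ, (1 : ℝ) :=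
              intervalIntegral.integral_mono_on hδ.le (intervalIntegrable_translate hwl x 0 δ)
                intervalIntegrable_const fun t _ => decayWeight_le_one _
          _ = δ := by simp
      calc steklov δ Φ x = (1 / δ) * ∫ t in (0 : ℝ)..δ, Φ (x + t) := rfl
        _ ≤ (1 / δ) * (1 + δ) := by rw [e1]; gcongr
        _ = 1 / δ + 1 := by field_simp
    have h2 := decayWeight_le_one x
    have he : 2 ≤ Real.exp 1 := by linarith [Real.add_one_le_exp (1 : ℝ)]
    have : 0 < 1 / δ := by positivity
    nlinarith
  have hpt : ∀ t ∈ Set.Icc 0 δ,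
      |f (x + t)| ≤ C * A ^ (1 / p x) * (1 + (1 / A) * Φ (x + t)) := by
    intro t ht
    have hq := hp.one_le (x + t)
    calc |f (x + t)| = (|f (x + t)| ^ p (x + t)) ^ (1 / p (x + t)) := by
          rw [← Real.rpow_mul (abs_nonneg _), mul_one_div_cancel (by linarith), Real.rpow_one]
      _ ≤ Φ (x + t) ^ (1 / p (x + t)) := by
          refine Real.rpow_le_rpow (by positivity) ?_ (by positivity)
          simp only [hΦ]; linarith [decayWeight_pos (x + t)]
      _ ≤ C * A ^ (1 / p x) * (1 + Φ (x + t) / A) := by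
          refine rpow_inv_le_of_exponent_bound (hp.one_le x) hq hA0 (hΦ0 _) hC1
            (fun h => hp.local_exponent_bound hδ ?_ h hAle)
            (fun z hz1 hAz hΦz => hp.decay_exponent_bound hz1 (by linarith) ?_)
          · rw [abs_sub_comm, add_sub_cancel_left, abs_of_nonneg ht.1]; exact ht.2
          · have : 0 ≤ |f (x + t)| ^ p (x + t) := by positivity
            refine le_trans ?_ hΦz
            simp only [hΦ]; linarith
      _ = _ := by ring
  have hr : LocallyIntegrable fun y => C * A ^ (1 / p x) * (1 + (1 / A) * Φ y) := by
    have h1 : LocallyIntegrable fun y => (1 : ℝ) + (1 / A) * Φ y :=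
      continuous_const.locallyIntegrable.add (hΦl.smul (1 / A))
    exact h1.smul (C * A ^ (1 / p x))
  have hmain : steklov δ (fun y => |f y|) x ≤ 2 * C * A ^ (1 / p x) := by
    calc _ ≤ steklov δ (fun y => C * A ^ (1 / p x) * (1 + (1 / A) * Φ y)) x :=
          steklov_mono hδ (locallyIntegrable_abs hfl) hr hpt
      _ = C * A ^ (1 / p x) * (1 + (1 / A) * steklov δ Φ x) := by
          simp only [steklov]
          rw [intervalIntegral.integral_const_mul, intervalIntegral.integral_add
            intervalIntegrable_const ((intervalIntegrable_translate hΦl x 0 δ).const_mul _),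
            intervalIntegral.integral_const_mul]
          simp only [intervalIntegral.integral_const, sub_zero, smul_eq_mul, mul_one]
          field_simp
      _ ≤ C * A ^ (1 / p x) * (1 + (1 / A) * A) := by gcongr
      _ = _ := by field_simp; ring
  have hpx := hp.one_le x
  calc _ ≤ (A ^ (1 / p x)) ^ p x := by
        refine Real.rpow_le_rpow (div_nonneg (steklov_nonneg hδ (fun t => abs_nonneg _) x)
          (by positivity)) ?_ (by linarith)
        rw [div_le_iff₀ (by positivity)]
        linarith
    _ = A := by rw [← Real.rpow_mul hA0.le, one_div_mul_cancel (by linarith), Real.rpow_one]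

/-- The norm bound for all Steklov averages. -/
def avgConst (c : ℝ) : ℝ := 20 * Real.exp (4 * c)

theorem avgConst_pos (c : ℝ) : 0 < avgConst c := by unfold avgConst; positivity

theorem IsPLog.modular_steklov_lt_one (hp : IsPLog p c₁ c₂) {f : ℝ → ℝ} (hfm : AEMeasurable f)
    (hf : modular p f < 1) {δ : ℝ} (hδ : 0 < δ) :
    modular p (fun x => steklov δ (fun y => |f y|) x / avgConst (max c₁ c₂)) < 1 := by
  have hpm := hp.measurable
  have hl : LocallyIntegrable f := InLp.locallyIntegrable hpm hp.one_le
    ⟨hfm, 1, one_pos, by simpa using hf.trans ENNReal.one_lt_top⟩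
  have hm : AEMeasurable fun y => |f y| ^ p y := by fun_prop
  have hi : Integrable fun y => |f y| ^ p y := by
    refine ⟨hm.aestronglyMeasurable, ?_⟩
    rw [hasFiniteIntegral_iff_ofReal (ae_of_all _ fun y => by positivity)]
    exact hf.trans ENNReal.one_lt_top
  have h1 : ∫ y, |f y| ^ p y ≤ 1 := by
    rw [integral_eq_lintegral_of_nonneg_ae (ae_of_all _ fun y => by positivity)
      hm.aestronglyMeasurable]
    exact ENNReal.toReal_le_of_le_ofReal zero_le_one (by simpa [modular] using hf.le)
  -- The factor 20 is 2 · 10: the 2 comes from the pointwise inequality, and 10 exceeds the modular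
  -- bound 9 = 1 + 4 + 4.
  have e : (fun x => steklov δ (fun y => |f y|) x / avgConst (max c₁ c₂)) =
      fun x => steklov δ (fun y => |f y|) x / (2 * Real.exp (4 * max c₁ c₂)) / 10 := by
    funext x; rw [avgConst]; field_simp; ring
  rw [e]
  refine (modular_div_le hp.one_le (by norm_num) _).trans_lt ?_
  have hwl : LocallyIntegrable decayWeight := continuous_decayWeight.locallyIntegrable
  have hΦl : LocallyIntegrable fun y => |f y| ^ p y + decayWeight y :=
    hi.locallyIntegrable.add hwl
  have hΦ0 : ∀ y, 0 ≤ |f y| ^ p y + decayWeight y := fun y => by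
    have := (decayWeight_pos y).le; positivity
  have hw : Measurable fun x => ENNReal.ofReal (decayWeight x) :=
    continuous_decayWeight.measurable.ennreal_ofReal
  have h2 : modular p (fun x =>
      steklov δ (fun y => |f y|) x / (2 * Real.exp (4 * max c₁ c₂))) ≤ ENNReal.ofReal 9 := by
    calc _ ≤ ∫⁻ x, (ENNReal.ofReal (steklov δ (fun y => |f y| ^ p y + decayWeight y) x) +
          ENNReal.ofReal (decayWeight x)) := by
          refine lintegral_mono fun x => ?_
          simp only
          rw [← ENNReal.ofReal_add (steklov_nonneg hδ hΦ0 x) (decayWeight_pos x).le]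
          refine ENNReal.ofReal_le_ofReal ?_
          rw [abs_of_nonneg (div_nonneg (steklov_nonneg hδ (fun t => abs_nonneg _) x)
            (by positivity))]
          exact hp.steklov_rpow_le hl hi h1 hδ x
      _ ≤ (∫⁻ x, ENNReal.ofReal (|f x| ^ p x + decayWeight x)) +
          ∫⁻ x, ENNReal.ofReal (decayWeight x) := by
          rw [lintegral_add_right _ hw]
          exact add_le_add (lintegral_steklov_le hδ hΦ0 hΦl) le_rfl
      _ = (modular p f + ∫⁻ x, ENNReal.ofReal (decayWeight x)) +
          ∫⁻ x, ENNReal.ofReal (decayWeight x) := by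
          congr 1
          rw [modular, ← lintegral_add_right _ hw]
          refine lintegral_congr fun x => ?_
          rw [ENNReal.ofReal_add (by positivity) (decayWeight_pos x).le]
      _ ≤ (ENNReal.ofReal 1 + ENNReal.ofReal 4) + ENNReal.ofReal 4 := by
          have h1 : modular p f ≤ ENNReal.ofReal 1 := by simpa using hf.le
          have h4 := lintegral_decayWeight_le
          gcongr
      _ = _ := by
          rw [← ENNReal.ofReal_add (by norm_num) (by norm_num),
            ← ENNReal.ofReal_add (by norm_num) (by norm_num)]; norm_num
  refine (mul_le_mul_right h2 _).trans_lt ?_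
  rw [← ENNReal.ofReal_mul (by norm_num), ENNReal.ofReal_lt_one]
  norm_num

theorem IsPLog.luxNorm_steklov_abs_le (hp : IsPLog p c₁ c₂) {f : ℝ → ℝ} (hfm : AEMeasurable f)
    {δ : ℝ} (hδ : 0 < δ) :
    luxNorm p (steklov δ fun y => |f y|) ≤
      ENNReal.ofReal (avgConst (max c₁ c₂)) * luxNorm p f := by
  have hC := avgConst_pos (max c₁ c₂)
  rw [luxNorm.eq_def p f, ENNReal.mul_iInf_of_ne (by simpa using hC) ENNReal.ofReal_ne_top]
  refine le_iInf fun η => ?_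
  rw [ENNReal.mul_iInf_of_ne (by simpa using hC) ENNReal.ofReal_ne_top]
  refine le_iInf fun hη => ?_
  rw [← ENNReal.ofReal_mul hC.le]
  refine luxNorm_le_ofReal (mul_pos hC hη.1) ?_
  have h := hp.modular_steklov_lt_one (hfm.div_const η) hη.2 hδ
  convert h using 2
  funext x
  simp only [steklov, abs_div, abs_of_pos hη.1]
  rw [intervalIntegral.integral_div]
  have := hη.1.ne'
  field_simp

end Averaging

/-! ### Primitives of locally integrable functions -/

section Primitives

/-- `u` is a primitive of the locally integrable function `v`. -/
structure IsPrimitive (u v : ℝ → ℝ) : Prop where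
  locallyIntegrable : LocallyIntegrable v
  integral_eq : ∀ a b, ∫ t in a..b, v t = u b - u a

theorem intervalIntegrable_of_locallyIntegrable {u : ℝ → ℝ} (hu : LocallyIntegrable u) (a b : ℝ) :
    IntervalIntegrable u volume a b :=
  (hu.integrableOn_isCompact isCompact_uIcc).intervalIntegrable

theorem isPrimitive_integral {f : ℝ → ℝ} (hf : LocallyIntegrable f) :
    IsPrimitive (fun x => ∫ t in (0 : ℝ)..x, f t) f :=
  ⟨hf, fun _ _ => (intervalIntegral.integral_interval_sub_left
    (intervalIntegrable_of_locallyIntegrable hf _ _)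
    (intervalIntegrable_of_locallyIntegrable hf _ _)).symm⟩

theorem IsPrimitive.eq_add_integral {u v : ℝ → ℝ} (h : IsPrimitive u v) (x : ℝ) :
    u x = u 0 + ∫ t in (0 : ℝ)..x, v t := by
  rw [h.integral_eq]; ring

theorem IsPrimitive.continuous {u v : ℝ → ℝ} (h : IsPrimitive u v) : Continuous u := by
  rw [funext h.eq_add_integral]
  exact continuous_const.add (intervalIntegral.continuous_primitive
    (intervalIntegrable_of_locallyIntegrable h.locallyIntegrable) 0)

theorem IsPrimitive.absolutelyContinuous {u v : ℝ → ℝ} (h : IsPrimitive u v) (a b : ℝ) :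
    AbsolutelyContinuousOnInterval u a b := by
  have e : u = fun x => u a + ∫ t in a..x, v t := by
    funext x; rw [h.integral_eq]; ring
  have h1 := (intervalIntegrable_of_locallyIntegrable h.locallyIntegrable a
    b).absolutelyContinuousOnInterval_intervalIntegral (c := a) (by simp)
  have h2 : AbsolutelyContinuousOnInterval (fun _ : ℝ => u a) a b :=
    (LipschitzWith.const (u a)).lipschitzOnWith.absolutelyContinuousOnInterval
  rw [e]
  exact h2.add h1

theorem IsPrimitive.deriv_ae_eq {u v : ℝ → ℝ} (h : IsPrimitive u v) : deriv u =ᵐ[volume] v := by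
  filter_upwards [LocallyIntegrable.ae_hasDerivAt_integral h.locallyIntegrable] with x hx
  rw [funext h.eq_add_integral]
  exact ((hx 0).const_add (u 0)).deriv

theorem IsPrimitive.integral_mul {u v φ φ' : ℝ → ℝ} (h : IsPrimitive u v)
    (hφ : ∀ x, HasDerivAt φ (φ' x) x) (hφ' : Continuous φ') (a b : ℝ) :
    ∫ t in a..b, φ t * v t = φ b * u b - φ a * u a - ∫ t in a..b, φ' t * u t := by
  have hp : IsPrimitive φ φ' :=
    ⟨hφ'.locallyIntegrable, fun a b => intervalIntegral.integral_eq_sub_of_hasDerivAt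
      (fun x _ => hφ x) (hφ'.intervalIntegrable _ _)⟩
  have := (hp.absolutelyContinuous a b).integral_mul_deriv_eq_deriv_mul (h.absolutelyContinuous a b)
  rw [funext fun x => (hφ x).deriv] at this
  rw [← this]
  refine intervalIntegral.integral_congr_ae ?_
  filter_upwards [h.deriv_ae_eq] with t ht _
  rw [ht]

theorem isPrimitive_steklov {u : ℝ → ℝ} (hu : LocallyIntegrable u) (δ : ℝ) :
    IsPrimitive (steklov δ u) fun x => δ⁻¹ * (u (x + δ) - u x) := by
  have hi := intervalIntegrable_of_locallyIntegrable hu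
  have hs : LocallyIntegrable fun x => u (x + δ) := by
    have := (measurePreserving_add_right volume δ)
    intro x
    obtain ⟨s, hs, hs'⟩ := hu (x + δ)
    refine ⟨(fun y => y + δ) ⁻¹' s, (continuous_add_const δ).continuousAt.preimage_mem_nhds hs, ?_⟩
    exact (this.integrableOn_comp_preimage (measurableEmbedding_addRight δ)).2 hs'
  refine ⟨(hs.sub hu).smul δ⁻¹, fun a b => ?_⟩
  have hs' := intervalIntegrable_of_locallyIntegrable hs a b
  rw [intervalIntegral.integral_const_mul, intervalIntegral.integral_sub hs' (hi _ _),
    intervalIntegral.integral_comp_add_right, steklov_eq_primitive hu, steklov_eq_primitive hu,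
    ← intervalIntegral.integral_interval_sub_left (hi 0 (b + δ)) (hi 0 (a + δ)),
    ← intervalIntegral.integral_interval_sub_left (hi 0 b) (hi 0 a)]
  ring

theorem IsPrimitive.steklov_eq {u v : ℝ → ℝ} (h : IsPrimitive u v) (δ x : ℝ) :
    steklov δ v x = δ⁻¹ * (u (x + δ) - u x) := by
  rw [steklov, intervalIntegral.integral_comp_add_left, h.integral_eq, add_zero, one_div]

theorem IsPrimitive.steklov {u v : ℝ → ℝ} (h : IsPrimitive u v) (δ : ℝ) :
    IsPrimitive (steklov δ u) (steklov δ v) := by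
  rw [funext (h.steklov_eq δ)]
  exact isPrimitive_steklov h.continuous.locallyIntegrable δ

end Primitives

/-! ### Averages against Taylor remainder kernels -/

section TaylorAverage

/-- The average of `f` over `[x, x + δ]` against the Taylor remainder kernel `(1 - t/δ)^n / n!`. -/
def taylorAvg (δ : ℝ) (n : ℕ) (f : ℝ → ℝ) (x : ℝ) : ℝ :=
  (1 / δ) * ∫ t in (0 : ℝ)..δ, (1 - t / δ) ^ n / n.factorial * f (x + t)

theorem taylorAvg_zero (δ : ℝ) (f : ℝ → ℝ) : taylorAvg δ 0 f = steklov δ f := by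
  funext x; simp [taylorAvg, VarExp.steklov]

/-- Integration by parts: differentiating the kernel lowers its order with factor -1/δ, and the
boundary term vanishes at t = δ and survives at t = 0. -/
theorem IsPrimitive.taylorAvg_succ {u v : ℝ → ℝ} (h : IsPrimitive u v) {δ : ℝ} (hδ : 0 < δ) (n : ℕ)
    (x : ℝ) :
    taylorAvg δ (n + 1) v x = δ⁻¹ * (taylorAvg δ n u x - 1 / (n + 1).factorial * u x) := by
  have h' : IsPrimitive (fun t => u (x + t)) fun t => v (x + t) := by
    refine ⟨?_, fun a b => by
      rw [intervalIntegral.integral_comp_add_left, h.integral_eq]⟩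
    have := (measurePreserving_add_left volume x)
    intro y
    obtain ⟨s, hs, hs'⟩ := h.locallyIntegrable (x + y)
    refine ⟨(fun t => x + t) ⁻¹' s, (continuous_const_add x).continuousAt.preimage_mem_nhds hs, ?_⟩
    exact (this.integrableOn_comp_preimage (measurableEmbedding_addLeft x)).2 hs'
  have hd : ∀ t, HasDerivAt (fun t => (1 - t / δ) ^ (n + 1) / (n + 1).factorial)
      (-(1 / δ) * ((1 - t / δ) ^ n / n.factorial)) t := fun t => by
    have h1 : HasDerivAt (fun t => 1 - t / δ) (-(1 / δ)) t := by
      simpa using ((hasDerivAt_id t).div_const δ).const_sub 1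
    have h2 := (h1.pow (n + 1)).div_const ((n + 1).factorial : ℝ)
    have h3 : -(1 / δ) * ((1 - t / δ) ^ n / n.factorial) =
        ((n + 1 : ℕ) : ℝ) * (1 - t / δ) ^ (n + 1 - 1) * -(1 / δ) / (n + 1).factorial := by
      have : (n.factorial : ℝ) ≠ 0 := by positivity
      rw [Nat.factorial_succ, Nat.add_sub_cancel]
      push_cast
      field_simp
    rw [h3]
    exact h2
  rw [taylorAvg, h'.integral_mul hd (by fun_prop), taylorAvg]
  simp_rw [mul_assoc (-(1 / δ))]
  rw [intervalIntegral.integral_const_mul]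
  simp [hδ.ne']
  ring

/-- Total mass of the kernel, read off by applying the recursion to the constant 1, whose derivative
is 0. -/
theorem taylorAvg_one (δ : ℝ) (hδ : 0 < δ) (n : ℕ) (x : ℝ) :
    taylorAvg δ n (fun _ => 1) x = 1 / (n + 1).factorial := by
  have h : IsPrimitive (fun _ => 1) fun _ => 0 := ⟨continuous_const.locallyIntegrable, by simp⟩
  have h1 := h.taylorAvg_succ hδ n x
  have h2 : taylorAvg δ (n + 1) (fun _ => 0) x = 0 := by simp [taylorAvg]
  rw [h2, eq_comm, mul_eq_zero, or_iff_right (inv_ne_zero hδ.ne')] at h1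
  linarith

theorem continuous_taylorAvg {δ : ℝ} (hδ : 0 < δ) (n : ℕ) {f : ℝ → ℝ} (hf : LocallyIntegrable f) :
    Continuous (taylorAvg δ n f) := by
  induction n generalizing f with
  | zero => rw [taylorAvg_zero]; exact continuous_steklov hf δ
  | succ n ih =>
    have h := isPrimitive_integral hf
    rw [funext (h.taylorAvg_succ hδ n)]
    exact continuous_const.mul ((ih h.continuous.locallyIntegrable).sub
      (continuous_const.mul h.continuous))

theorem taylorAvg_intervalIntegrable (δ : ℝ) (n : ℕ) {f : ℝ → ℝ} (hf : LocallyIntegrable f)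
    (x : ℝ) : IntervalIntegrable (fun t => (1 - t / δ) ^ n / n.factorial * f (x + t)) volume 0 δ :=
  (intervalIntegrable_translate hf x 0 δ).continuousOn_mul (by fun_prop)

theorem taylorAvg_add (δ : ℝ) (n : ℕ) {f g : ℝ → ℝ} (hf : LocallyIntegrable f)
    (hg : LocallyIntegrable g) (x : ℝ) :
    taylorAvg δ n (f + g) x = taylorAvg δ n f x + taylorAvg δ n g x := by
  simp only [taylorAvg, Pi.add_apply, mul_add]
  rw [intervalIntegral.integral_add (taylorAvg_intervalIntegrable δ n hf x)
    (taylorAvg_intervalIntegrable δ n hg x), mul_add]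

theorem taylorAvg_smul (δ : ℝ) (n : ℕ) (c : ℝ) (f : ℝ → ℝ) (x : ℝ) :
    taylorAvg δ n (c • f) x = c * taylorAvg δ n f x := by
  simp only [taylorAvg, Pi.smul_apply, smul_eq_mul]
  simp_rw [mul_left_comm _ c]
  rw [intervalIntegral.integral_const_mul, mul_left_comm]

theorem lintegral_taylorAvg_le {δ : ℝ} (hδ : 0 < δ) (n : ℕ) {f : ℝ → ℝ} (hf : LocallyIntegrable f)
    (a b : ℝ) :
    ∫⁻ y in Set.Ioc a b, ‖taylorAvg δ n f y‖ₑ ≤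
      ENNReal.ofReal (1 / (n + 1).factorial) * ∫⁻ y in Set.Ioc a (b + δ), ‖f y‖ₑ := by
  set φ : ℝ → ℝ≥0∞ := fun t => ENNReal.ofReal (1 / δ * |(1 - t / δ) ^ n / n.factorial|)
  have h1 : ∀ y, ‖taylorAvg δ n f y‖ₑ ≤ ∫⁻ t in Set.Ioc 0 δ, φ t * ‖f (y + t)‖ₑ := fun y => by
    rw [taylorAvg, ← intervalIntegral.integral_const_mul, intervalIntegral.integral_of_le hδ.le]
    refine (enorm_integral_le_lintegral_enorm _).trans (lintegral_mono fun t => ?_)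
    simp only [φ]
    rw [← mul_assoc, enorm_mul, enorm_mul, ENNReal.ofReal_mul (by positivity),
      Real.enorm_eq_ofReal_abs, Real.enorm_eq_ofReal_abs, abs_of_nonneg (by positivity : 0 ≤ 1 / δ)]
  have h2 : ∫⁻ t in Set.Ioc 0 δ, φ t = ENNReal.ofReal (1 / (n + 1).factorial) := by
    rw [← taylorAvg_one δ hδ n 0, taylorAvg, ENNReal.ofReal_mul (by positivity),
      intervalIntegral.integral_of_le hδ.le, ofReal_integral_eq_lintegral_ofReal,
      ← lintegral_const_mul' _ _ ENNReal.ofReal_ne_top]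
    · refine setLIntegral_congr_fun measurableSet_Ioc fun t ht => ?_
      have : 0 ≤ 1 - t / δ := by
        rw [sub_nonneg, div_le_one hδ]; exact ht.2
      simp only [φ]
      rw [ENNReal.ofReal_mul (by positivity), abs_of_nonneg (by positivity), mul_one]
    · exact (Continuous.integrableOn_Ioc (by fun_prop))
    · refine (ae_restrict_iff' measurableSet_Ioc).2 (ae_of_all _ fun t ht => ?_)
      have : 0 ≤ 1 - t / δ := by
        rw [sub_nonneg, div_le_one hδ]; exact ht.2
      simp only [Pi.zero_apply]
      positivity
  rw [← h2]
  refine (lintegral_mono h1).trans (lintegral_lintegral_translate_le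
    hf.aestronglyMeasurable.enorm (by fun_prop) ?_ measurableSet_Ioc measurableSet_Ioc
    measurableSet_Ioc)
  intro y hy t ht
  exact ⟨by linarith [hy.1, ht.1], by linarith [hy.2, ht.2]⟩

end TaylorAverage

/-! ### The operators on locally integrable functions and their commutation -/

section Operators

/-- The submodule of locally integrable functions on the line. -/
def locIntSubmodule : Submodule ℝ (ℝ → ℝ) where
  carrier := {f | LocallyIntegrable f volume}
  add_mem' := fun hf hg => hf.add hg
  zero_mem' := locallyIntegrable_zero
  smul_mem' := fun c _ hf => hf.smul c

/-- The space of locally integrable functions on the line. -/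
def LocInt : Type := locIntSubmodule

instance : AddCommGroup LocInt := inferInstanceAs (AddCommGroup locIntSubmodule)

instance : Module ℝ LocInt := inferInstanceAs (Module ℝ locIntSubmodule)

/-- The function underlying an element of `LocInt`. -/
@[coe]
def LocInt.toFun (f : LocInt) : ℝ → ℝ := Subtype.val f

instance : CoeOut LocInt (ℝ → ℝ) := ⟨LocInt.toFun⟩

theorem LocInt.ext {f g : LocInt} (h : ∀ x, (f : ℝ → ℝ) x = (g : ℝ → ℝ) x) : f = g :=
  Subtype.ext (funext h)

theorem LocInt.locallyIntegrable (f : LocInt) : LocallyIntegrable (f : ℝ → ℝ) := Subtype.prop f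

theorem LocInt.aemeasurable (f : LocInt) : AEMeasurable (f : ℝ → ℝ) :=
  f.locallyIntegrable.aestronglyMeasurable.aemeasurable

variable {δ : ℝ}

/-- The averages `taylorAvg` as linear operators. -/
def avgOp (hδ : 0 < δ) (n : ℕ) : Module.End ℝ LocInt where
  toFun f := ⟨taylorAvg δ n f, (continuous_taylorAvg hδ n f.locallyIntegrable).locallyIntegrable⟩
  map_add' f g := LocInt.ext (fun x => taylorAvg_add δ n f.locallyIntegrable g.locallyIntegrable x)
  map_smul' c f := LocInt.ext (fun x => taylorAvg_smul δ n c f x)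

theorem locallyIntegrable_translate {u : ℝ → ℝ} (hu : LocallyIntegrable u) (δ : ℝ) :
    LocallyIntegrable fun x => u (x + δ) := by
  intro x
  obtain ⟨s, hs, hs'⟩ := hu (x + δ)
  exact ⟨(fun y => y + δ) ⁻¹' s, (continuous_add_const δ).continuousAt.preimage_mem_nhds hs,
    ((measurePreserving_add_right volume δ).integrableOn_comp_preimage
      (measurableEmbedding_addRight δ)).2 hs'⟩

/-- Translation by `δ` as a linear operator. -/
def shiftOp (δ : ℝ) : Module.End ℝ LocInt where
  toFun f := ⟨fun x => (f : ℝ → ℝ) (x + δ), locallyIntegrable_translate f.locallyIntegrable δ⟩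
  map_add' _ _ := rfl
  map_smul' _ _ := rfl

theorem avgOp_apply (hδ : 0 < δ) (n : ℕ) (f : LocInt) (x : ℝ) :
    (avgOp hδ n f : ℝ → ℝ) x = taylorAvg δ n f x := rfl

theorem coe_avgOp_zero (hδ : 0 < δ) (f : LocInt) : (avgOp hδ 0 f : ℝ → ℝ) = steklov δ f :=
  taylorAvg_zero δ f

theorem shiftOp_apply (f : LocInt) (x : ℝ) : (shiftOp δ f : ℝ → ℝ) x = (f : ℝ → ℝ) (x + δ) := rfl

theorem IsPrimitive.avgOp_succ (hδ : 0 < δ) (n : ℕ) {u v : LocInt}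
    (h : IsPrimitive (u : ℝ → ℝ) (v : ℝ → ℝ)) :
    avgOp hδ (n + 1) v = δ⁻¹ • (avgOp hδ n u - (1 / (n + 1).factorial : ℝ) • u) :=
  LocInt.ext (fun x => h.taylorAvg_succ hδ n x)

theorem isPrimitive_avgOp_zero (hδ : 0 < δ) (f : LocInt) :
    IsPrimitive (avgOp hδ 0 f : ℝ → ℝ) ((δ⁻¹ • (shiftOp δ f - f) : LocInt) : ℝ → ℝ) := by
  rw [coe_avgOp_zero]
  exact isPrimitive_steklov f.locallyIntegrable δ

/-- Tf is a primitive of δ⁻¹(S-1)f, so the integration by parts recursion applies to this pair. All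
later operator identities rest on the cases n = 0 and n = 1. -/
theorem avgOp_succ_mul_shiftOp_sub_one (hδ : 0 < δ) (n : ℕ) :
    avgOp hδ (n + 1) * (shiftOp δ - 1) =
      avgOp hδ n * avgOp hδ 0 - (1 / (n + 1).factorial : ℝ) • avgOp hδ 0 := by
  refine LinearMap.ext fun f => ?_
  have h := (isPrimitive_avgOp_zero hδ f).avgOp_succ hδ n
  rw [map_smul] at h
  exact smul_right_injective _ (inv_ne_zero hδ.ne') h

theorem exists_isPrimitive (f : LocInt) : ∃ u : LocInt, IsPrimitive (u : ℝ → ℝ) (f : ℝ → ℝ) :=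
  ⟨⟨_, (isPrimitive_integral f.locallyIntegrable).continuous.locallyIntegrable⟩, isPrimitive_integral f.locallyIntegrable⟩

/-- Induction along primitives: if u is a primitive of f, then Tu is a primitive of Tf, and the
recursion reduces order n + 1 on f to order n on u. -/
theorem commute_avgOp (hδ : 0 < δ) (n : ℕ) : Commute (avgOp hδ n) (avgOp hδ 0) := by
  induction n with
  | zero => exact Commute.refl _
  | succ n ih =>
    refine LinearMap.ext fun f => ?_
    obtain ⟨u, hu⟩ := exists_isPrimitive f
    have h1 : IsPrimitive (avgOp hδ 0 u : ℝ → ℝ) (avgOp hδ 0 f : ℝ → ℝ) := by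
      rw [coe_avgOp_zero, coe_avgOp_zero]; exact hu.steklov δ
    have h2 : avgOp hδ n (avgOp hδ 0 u) = avgOp hδ 0 (avgOp hδ n u) := LinearMap.congr_fun ih u
    rw [Module.End.mul_apply, Module.End.mul_apply, h1.avgOp_succ hδ n, hu.avgOp_succ hδ n,
      map_smul, map_sub, map_smul, h2]

theorem commute_shiftOp (hδ : 0 < δ) (n : ℕ) : Commute (shiftOp δ) (avgOp hδ n) := by
  refine LinearMap.ext fun f => LocInt.ext (fun x => ?_)
  rw [Module.End.mul_apply, Module.End.mul_apply, shiftOp_apply, avgOp_apply, avgOp_apply,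
    taylorAvg, taylorAvg]
  simp_rw [shiftOp_apply]
  congr 2; funext t
  rw [add_right_comm]

end Operators

/-! ### Local mass and reach of operators -/

section OpBound

variable {δ : ℝ}

/-- `L` has mass at most `M` and reaches at most `k` steps of length `δ` to the right. -/
def OpBound (δ : ℝ) (L : Module.End ℝ LocInt) (M : NNReal) (k : ℕ) : Prop :=
  ∀ (f : LocInt) (a b : ℝ), ∫⁻ y in Set.Ioc a b, ‖(L f : ℝ → ℝ) y‖ₑ ≤
    M * ∫⁻ y in Set.Ioc a (b + k * δ), ‖(f : ℝ → ℝ) y‖ₑ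

variable {L L' : Module.End ℝ LocInt} {M M' : NNReal} {k k' : ℕ}

theorem OpBound.mono (hδ : 0 < δ) (h : OpBound δ L M k) (hM : M ≤ M') (hk : k ≤ k') :
    OpBound δ L M' k' := fun f a b => by
  refine (h f a b).trans ?_
  have : (k : ℝ) ≤ k' := by exact_mod_cast hk
  gcongr

theorem OpBound.add (h : OpBound δ L M k) (h' : OpBound δ L' M' k) :
    OpBound δ (L + L') (M + M') k := fun f a b => by
  have hm : AEMeasurable (fun y => ‖(L f : ℝ → ℝ) y‖ₑ) (volume.restrict (Set.Ioc a b)) :=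
    (LocInt.aemeasurable (L f)).enorm.restrict
  calc _ ≤ ∫⁻ y in Set.Ioc a b, (‖(L f : ℝ → ℝ) y‖ₑ + ‖(L' f : ℝ → ℝ) y‖ₑ) :=
        lintegral_mono fun y => enorm_add_le _ _
    _ = (∫⁻ y in Set.Ioc a b, ‖(L f : ℝ → ℝ) y‖ₑ) + ∫⁻ y in Set.Ioc a b, ‖(L' f : ℝ → ℝ) y‖ₑ :=
        lintegral_add_left' hm _
    _ ≤ _ := by
        rw [ENNReal.coe_add, add_mul]
        exact add_le_add (h f a b) (h' f a b)

theorem OpBound.neg (h : OpBound δ L M k) : OpBound δ (-L) M k := fun f a b => by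
  have e : ∀ y, ‖((-L) f : ℝ → ℝ) y‖ₑ = ‖(L f : ℝ → ℝ) y‖ₑ := fun y => enorm_neg _
  simp_rw [e]
  exact h f a b

theorem OpBound.sub (h : OpBound δ L M k) (h' : OpBound δ L' M' k) :
    OpBound δ (L - L') (M + M') k := by
  have e : L - L' = L + -L' := sub_eq_add_neg L L'
  rw [e]
  exact h.add h'.neg

theorem OpBound.mul (h : OpBound δ L M k) (h' : OpBound δ L' M' k') :
    OpBound δ (L * L') (M * M') (k + k') := fun f a b => by
  refine (h (L' f) a b).trans ?_
  rw [ENNReal.coe_mul, mul_assoc]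
  refine mul_le_mul' le_rfl ((h' f _ _).trans (le_of_eq ?_))
  push_cast
  rw [add_mul, add_assoc]

theorem opBound_one : OpBound δ 1 1 0 := fun f a b => by simp

theorem opBound_zero : OpBound δ 0 M 0 := fun f a b => by
  have e : ∀ y, ‖((0 : Module.End ℝ LocInt) f : ℝ → ℝ) y‖ₑ = 0 := fun y => enorm_zero
  simp_rw [e]
  simp

theorem OpBound.pow (h : OpBound δ L M k) (n : ℕ) : OpBound δ (L ^ n) (M ^ n) (n * k) := by
  induction n with
  | zero => simpa using opBound_one
  | succ n ih => rw [pow_succ, pow_succ, add_mul, one_mul]; exact ih.mul h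

theorem OpBound.sum {ι : Type*} (s : Finset ι) {F : ι → Module.End ℝ LocInt} {m : ι → NNReal}
    (hδ : 0 < δ) (h : ∀ i ∈ s, OpBound δ (F i) (m i) k) :
    OpBound δ (∑ i ∈ s, F i) (∑ i ∈ s, m i) k := by
  classical
  induction s using Finset.induction_on with
  | empty => simpa using (opBound_zero (M := 0)).mono hδ le_rfl (Nat.zero_le k)
  | insert a s ha ih =>
    rw [Finset.sum_insert ha, Finset.sum_insert ha]
    exact (h a (Finset.mem_insert_self _ _)).add
      (ih fun i hi => h i (Finset.mem_insert_of_mem hi))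

theorem OpBound.nsmul (h : OpBound δ L M k) (c : NNReal) :
    OpBound δ ((c : ℝ) • L) (c * M) k := fun f a b => by
  have e : ∀ y, ‖(((c : ℝ) • L) f : ℝ → ℝ) y‖ₑ = c * ‖(L f : ℝ → ℝ) y‖ₑ := fun y => by
    change ‖(c : ℝ) * (L f : ℝ → ℝ) y‖ₑ = _
    rw [enorm_mul, Real.enorm_of_nonneg c.coe_nonneg, ENNReal.ofReal_coe_nnreal]
  simp_rw [e]
  rw [lintegral_const_mul' _ _ ENNReal.coe_ne_top, ENNReal.coe_mul, mul_assoc]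
  exact mul_le_mul' le_rfl (h f a b)

theorem opBound_avgOp (hδ : 0 < δ) (n : ℕ) :
    OpBound δ (avgOp hδ n) (1 / (n + 1).factorial) 1 := fun f a b => by
  have := lintegral_taylorAvg_le hδ n f.locallyIntegrable a b
  simp only [Nat.cast_one, one_mul]
  refine this.trans (le_of_eq ?_)
  congr 1
  rw [ENNReal.ofReal, ENNReal.coe_inj]
  apply NNReal.eq
  rw [Real.coe_toNNReal _ (by positivity)]
  simp

theorem opBound_shiftOp (hδ : 0 < δ) : OpBound δ (shiftOp δ) 1 1 := fun f a b => by
  have h := lintegral_lintegral_translate_le (s := Set.Ioc a b) (s' := Set.Ioc a (b + δ))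
    (I := {δ}) (f.locallyIntegrable.aestronglyMeasurable.aemeasurable.enorm) (measurable_const (a := 1))
    (fun y hy t ht => by
      rw [Set.mem_singleton_iff] at ht; subst ht
      exact ⟨by linarith [hy.1], by linarith [hy.2]⟩)
    measurableSet_Ioc measurableSet_Ioc (measurableSet_singleton δ)
  simp only [Nat.cast_one, one_mul, ENNReal.coe_one, ge_iff_le]
  have e : ∫⁻ y in Set.Ioc a b, ‖(f : ℝ → ℝ) (y + δ)‖ₑ =
      ∫⁻ y in Set.Ioc (a + δ) (b + δ), ‖(f : ℝ → ℝ) y‖ₑ := by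
    have := (measurePreserving_add_right volume δ).setLIntegral_comp_preimage_emb
      (measurableEmbedding_addRight δ) (fun y => ‖(f : ℝ → ℝ) y‖ₑ) (Set.Ioc (a + δ) (b + δ))
    simpa using this
  simp_rw [shiftOp_apply, e]
  exact lintegral_mono_set (Set.Ioc_subset_Ioc_left (by linarith))

end OpBound

/-! ### Exponentially weighted masses -/

section Weighted

variable {δ : ℝ} {ρ : NNReal}

/-- Operators with exponentially weighted mass at most the given number. -/
inductive WeightBound (δ : ℝ) (ρ : NNReal) : Module.End ℝ LocInt → NNReal → Prop
  | piece {L : Module.End ℝ LocInt} {M : NNReal} {k : ℕ} (h : OpBound δ L M k) :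
      WeightBound δ ρ L (M * ρ ^ k)
  | add {L L' : Module.End ℝ LocInt} {C C' : NNReal} (h : WeightBound δ ρ L C)
      (h' : WeightBound δ ρ L' C') : WeightBound δ ρ (L + L') (C + C')

variable {L L' : Module.End ℝ LocInt} {C C' : NNReal}

theorem WeightBound.mono (h : WeightBound δ ρ L C) (hC : C ≤ C') : WeightBound δ ρ L C' := by
  -- The surplus `D` is booked as the mass of an added zero operator.
  obtain ⟨D, rfl⟩ := exists_add_of_le hC
  simpa using h.add (WeightBound.piece (opBound_zero (M := D)))

theorem OpBound.weightBound {M : NNReal} {k : ℕ} (h : OpBound δ L M k) (hC : M * ρ ^ k ≤ C) :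
    WeightBound δ ρ L C :=
  (WeightBound.piece h).mono hC

theorem weightBound_one : WeightBound δ ρ 1 1 := opBound_one.weightBound (by simp)

theorem weightBound_zero : WeightBound δ ρ 0 0 := (opBound_zero (M := 0)).weightBound (by simp)

theorem WeightBound.mul (h : WeightBound δ ρ L C) (h' : WeightBound δ ρ L' C') :
    WeightBound δ ρ (L * L') (C * C') := by
  induction h with
  | @piece L M k h =>
    induction h' with
    | @piece L' M' k' h' =>
      exact (h.mul h').weightBound (by rw [pow_add]; exact le_of_eq (by ring))
    | add _ _ ih1 ih2 => rw [mul_add, mul_add]; exact ih1.add ih2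
  | add _ _ ih1 ih2 => rw [add_mul, add_mul]; exact ih1.add ih2

theorem WeightBound.pow (h : WeightBound δ ρ L C) (n : ℕ) : WeightBound δ ρ (L ^ n) (C ^ n) := by
  induction n with
  | zero => simpa using weightBound_one
  | succ n ih => rw [pow_succ, pow_succ]; exact ih.mul h

theorem WeightBound.sum {ι : Type*} (s : Finset ι) {F : ι → Module.End ℝ LocInt} {m : ι → NNReal}
    (h : ∀ i ∈ s, WeightBound δ ρ (F i) (m i)) :
    WeightBound δ ρ (∑ i ∈ s, F i) (∑ i ∈ s, m i) := by
  classical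
  induction s using Finset.induction_on with
  | empty => simpa using weightBound_zero
  | insert a s ha ih =>
    rw [Finset.sum_insert ha, Finset.sum_insert ha]
    exact (h a (Finset.mem_insert_self _ _)).add
      (ih fun i hi => h i (Finset.mem_insert_of_mem hi))

/-- If `E` and `X` differ by a small operator, so do their powers. -/
theorem exists_weightBound_pow_sub_pow (E : Module.End ℝ LocInt) {a : NNReal}
    (hE : WeightBound δ ρ E a) (b : NNReal) (r : ℕ) :
    ∃ K : NNReal, ∀ (X : Module.End ℝ LocInt) (η : NNReal), WeightBound δ ρ X b →
      WeightBound δ ρ (E - X) η → WeightBound δ ρ (E ^ r - X ^ r) (K * η) := by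
  induction r with
  | zero =>
    refine ⟨0, fun X η _ _ => ?_⟩
    have e : E ^ 0 - X ^ 0 = 0 := by rw [pow_zero, pow_zero]; exact sub_self _
    rw [e, zero_mul]
    exact weightBound_zero
  | succ r ih =>
    obtain ⟨K, hK⟩ := ih
    refine ⟨a * K + b ^ r, fun X η hX h => ?_⟩
    have e : E ^ (r + 1) - X ^ (r + 1) = E * (E ^ r - X ^ r) + (E - X) * X ^ r := by
      rw [pow_succ' E, pow_succ' X, mul_sub, sub_mul]
      exact (sub_add_sub_cancel _ _ _).symm
    rw [e]
    exact ((hE.mul (hK X η hX h)).add (h.mul (hX.pow r))).mono (le_of_eq (by ring))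

end Weighted

/-! ### From mass bounds to Luxemburg norm bounds -/

section NormBounds

variable {p : ℝ → ℝ} {c₁ c₂ δ : ℝ} {L : Module.End ℝ LocInt} {M : NNReal} {k : ℕ}

theorem enorm_taylorAvg_le (hδ : 0 < δ) (n : ℕ) {f : ℝ → ℝ} (x : ℝ) :
    ‖taylorAvg δ n f x‖ₑ ≤ ENNReal.ofReal (1 / δ) * ∫⁻ y in Set.Ioc x (x + δ), ‖f y‖ₑ := by
  rw [taylorAvg, enorm_mul, Real.enorm_of_nonneg (by positivity)]
  refine mul_le_mul' le_rfl ?_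
  rw [intervalIntegral.integral_of_le hδ.le]
  refine (enorm_integral_le_lintegral_enorm _).trans ?_
  have e : ∫⁻ y in Set.Ioc x (x + δ), ‖f y‖ₑ = ∫⁻ t in Set.Ioc 0 δ, ‖f (x + t)‖ₑ := by
    have := (measurePreserving_add_left volume x).setLIntegral_comp_preimage_emb
      (measurableEmbedding_addLeft x) (fun y => ‖f y‖ₑ) (Set.Ioc x (x + δ))
    simpa using this.symm
  rw [e]
  refine setLIntegral_mono' measurableSet_Ioc fun t ht => ?_
  rw [enorm_mul]
  refine mul_le_of_le_one_left' ?_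
  have h1 : 0 ≤ 1 - t / δ := by rw [sub_nonneg, div_le_one hδ]; exact ht.2
  have h2 : 1 - t / δ ≤ 1 := by
    have : 0 ≤ t / δ := div_nonneg ht.1.le hδ.le
    linarith
  rw [Real.enorm_of_nonneg (by positivity), ENNReal.ofReal_le_one]
  have h3 : (1 : ℝ) ≤ n.factorial := by exact_mod_cast Nat.one_le_iff_ne_zero.2 n.factorial_ne_zero
  rw [div_le_one (by positivity)]
  exact (pow_le_one₀ h1 h2).trans h3

/-- An averaged operator is dominated by a single average over a longer interval. -/
theorem OpBound.abs_avgOp_mul_le (hδ : 0 < δ) (h : OpBound δ L M k) (n : ℕ) (f : LocInt) (x : ℝ) :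
    |((avgOp hδ n * L) f : ℝ → ℝ) x| ≤
      M * (k + 1) * steklov ((k + 1) * δ) (fun y => |(f : ℝ → ℝ) y|) x := by
  have hk : 0 < ((k : ℝ) + 1) * δ := by positivity
  have h0 : 0 ≤ steklov ((k + 1) * δ) (fun y => |(f : ℝ → ℝ) y|) x :=
    steklov_nonneg hk (fun _ => abs_nonneg _) x
  rw [← ENNReal.ofReal_le_ofReal_iff (by positivity), ← Real.enorm_eq_ofReal_abs]
  -- The kernel is at most 1/δ, and the mass of `L f` on (x, x+δ] is at most M times that of f on
  -- (x, x+(k+1)δ], which is (k+1)δ times the long average of |f|.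
  refine (enorm_taylorAvg_le hδ n x).trans
    ((mul_le_mul' le_rfl (h f x (x + δ))).trans (le_of_eq ?_))
  have e1 : ENNReal.ofReal (steklov ((k + 1) * δ) (fun y => |(f : ℝ → ℝ) y|) x) =
      ENNReal.ofReal (1 / ((k + 1) * δ)) *
        ∫⁻ y in Set.Ioc x (x + δ + k * δ), ‖(f : ℝ → ℝ) y‖ₑ := by
    rw [steklov, intervalIntegral.integral_comp_add_left (fun y => |(f : ℝ → ℝ) y|), add_zero,
      intervalIntegral.integral_of_le (by linarith), ENNReal.ofReal_mul (by positivity),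
      ofReal_integral_eq_lintegral_ofReal]
    · simp_rw [Real.enorm_eq_ofReal_abs]
      congr 4; ring
    · exact ((locallyIntegrable_abs f.locallyIntegrable).integrableOn_isCompact isCompact_Icc).mono_set
        Set.Ioc_subset_Icc_self
    · exact ae_of_all _ fun y => abs_nonneg _
  rw [ENNReal.ofReal_mul (by positivity), e1, ← mul_assoc, ← mul_assoc, ← ENNReal.ofReal_mul
    (by positivity), ← ENNReal.ofReal_coe_nnreal, ← ENNReal.ofReal_mul (by positivity)]
  congr 2
  field_simp

theorem IsPLog.luxNorm_avgOp_mul_le (hp : IsPLog p c₁ c₂) (hδ : 0 < δ) (h : OpBound δ L M k)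
    (n : ℕ) (f : LocInt) :
    luxNorm p ((avgOp hδ n * L) f : ℝ → ℝ) ≤
      (M * (k + 1) : NNReal) * (ENNReal.ofReal (avgConst (max c₁ c₂)) * luxNorm p f) := by
  have hk : 0 < ((k : ℝ) + 1) * δ := by positivity
  have hp0 : ∀ x, 0 ≤ p x := fun x => by linarith [hp.one_le x]
  calc _ ≤ luxNorm p fun x => (M * (k + 1) : ℝ) *
        steklov ((k + 1) * δ) (fun y => |(f : ℝ → ℝ) y|) x := by
        refine luxNorm_mono hp0 (ae_of_all _ fun x => ?_)
        exact (h.abs_avgOp_mul_le hδ n f x).trans (le_abs_self _)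
    _ ≤ ENNReal.ofReal |(M * (k + 1) : ℝ)| *
        luxNorm p (steklov ((k + 1) * δ) fun y => |(f : ℝ → ℝ) y|) :=
        luxNorm_const_mul_le hp.one_le _ _
    _ ≤ _ := by
        refine mul_le_mul' (le_of_eq ?_) (hp.luxNorm_steklov_abs_le f.aemeasurable hk)
        rw [abs_of_nonneg (by positivity), ← ENNReal.ofReal_coe_nnreal]
        push_cast
        rfl

/-- The growth rate of the exponential weights. -/
def weightBase : NNReal := 21 / 20

/-- Bernoulli's inequality. The weight absorbs the linear loss in the reach. -/
theorem succ_le_weightBase_pow (k : ℕ) : (k + 1 : NNReal) ≤ 20 * weightBase ^ k := by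
  rw [← NNReal.coe_le_coe]
  have h := one_add_mul_le_pow (a := (1 / 20 : ℝ)) (by norm_num) k
  have e : (weightBase : ℝ) = 1 + 1 / 20 := by rw [weightBase]; push_cast; norm_num
  push_cast
  rw [e]
  linarith

/-- For a single piece the reach factor splits by k + l + 1 ≤ (k+1)(l+1), and the weight pays for l
+ 1. The resulting bound is linear in C, so it passes to sums of pieces. -/
theorem WeightBound.luxNorm_le (hp : IsPLog p c₁ c₂) (hδ : 0 < δ) {V : Module.End ℝ LocInt}
    (hV : OpBound δ V M k) {C : NNReal} (h : WeightBound δ weightBase L C) (f : LocInt) :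
    luxNorm p ((avgOp hδ 0 * V * L) f : ℝ → ℝ) ≤
      (M * (k + 1) * 20 * C : NNReal) * (ENNReal.ofReal (avgConst (max c₁ c₂)) * luxNorm p f) := by
  induction h with
  | @piece L m l h =>
    rw [mul_assoc]
    refine (hp.luxNorm_avgOp_mul_le hδ (hV.mul h) 0 f).trans (mul_le_mul' ?_ le_rfl)
    rw [ENNReal.coe_le_coe]
    push_cast
    calc M * m * (k + l + 1) ≤ M * m * ((k + 1) * (l + 1)) := by
          gcongr
          calc (k + l + 1 : NNReal) ≤ k + l + 1 + k * l := le_self_add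
            _ = (k + 1) * (l + 1) := by ring
      _ ≤ M * m * ((k + 1) * (20 * weightBase ^ l)) := by
          gcongr
          exact succ_le_weightBase_pow l
      _ = _ := by ring
  | @add L L' C C' _ _ ih1 ih2 =>
    have e : avgOp hδ 0 * V * (L + L') = avgOp hδ 0 * V * L + avgOp hδ 0 * V * L' := mul_add _ _ _
    rw [e]
    refine (luxNorm_add_le hp.measurable hp.one_le (LocInt.aemeasurable _)).trans
      ((add_le_add ih1 ih2).trans (le_of_eq ?_))
    rw [← add_mul, ← ENNReal.coe_add, ← mul_add]

end NormBounds

/-! ### Masses of powers of 1 - T -/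

section Algebra

variable {δ : ℝ}

/-- Since T² - T = A_1(S-1), cancellation leaves terms of masses 1, 1, 1/2, 1/2: total 3 instead of
the trivial 4. -/
theorem one_sub_avgOp_sq (hδ : 0 < δ) :
    (1 - avgOp hδ 0) ^ 2 = 1 - avgOp hδ 0 - avgOp hδ 1 + avgOp hδ 1 * shiftOp δ := by
  have h := avgOp_succ_mul_shiftOp_sub_one hδ 0
  simp only [zero_add, Nat.factorial_one, Nat.cast_one, div_one, one_smul] at h
  have e : (1 - avgOp hδ 0) ^ 2 = 1 - avgOp hδ 0 + (avgOp hδ 0 * avgOp hδ 0 - avgOp hδ 0) := by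
    noncomm_ring
  rw [e, ← h]
  noncomm_ring

theorem opBound_one_sub_avgOp (hδ : 0 < δ) : OpBound δ (1 - avgOp hδ 0) 2 1 :=
  ((opBound_one.mono hδ le_rfl zero_le_one).sub (opBound_avgOp hδ 0)).mono hδ
    (by simp; norm_num) le_rfl

theorem opBound_one_sub_avgOp_sq (hδ : 0 < δ) : OpBound δ ((1 - avgOp hδ 0) ^ 2) 3 2 := by
  rw [one_sub_avgOp_sq]
  have h1 := (opBound_one (δ := δ)).mono hδ le_rfl (Nat.zero_le 2)
  have h2 := (opBound_avgOp hδ 0).mono hδ le_rfl (one_le_two)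
  have h3 := (opBound_avgOp hδ 1).mono hδ le_rfl (one_le_two)
  have h4 := (opBound_avgOp hδ 1).mul (opBound_shiftOp hδ)
  refine (((h1.sub h2).sub h3).add h4).mono hδ ?_ le_rfl
  rw [← NNReal.coe_le_coe]
  push_cast
  simp only [Nat.factorial]
  norm_num

/-- Induction in steps of two, using 3 ≤ (7/4)². The prefactor 8/7 makes the case k = 1, of mass 2,
exact. -/
theorem opBound_one_sub_avgOp_pow (hδ : 0 < δ) (k : ℕ) :
    OpBound δ ((1 - avgOp hδ 0) ^ k) (8 / 7 * (7 / 4) ^ k) k := by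
  induction k using Nat.twoStepInduction with
  | zero =>
    rw [pow_zero]
    refine opBound_one.mono hδ ?_ le_rfl
    rw [← NNReal.coe_le_coe]; push_cast; norm_num
  | one =>
    rw [pow_one]
    refine (opBound_one_sub_avgOp hδ).mono hδ ?_ le_rfl
    rw [← NNReal.coe_le_coe]; push_cast; norm_num
  | more k ih _ =>
    rw [pow_add]
    refine (ih.mul (opBound_one_sub_avgOp_sq hδ)).mono hδ ?_ le_rfl
    rw [← NNReal.coe_le_coe]; push_cast
    have : (0 : ℝ) ≤ 8 / 7 * (7 / 4) ^ k := by positivity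
    rw [pow_add]
    nlinarith

theorem one_sub_avgOp_pow_eq (hδ : 0 < δ) (r : ℕ) :
    (1 - avgOp hδ 0) ^ r =
      1 - avgOp hδ 0 * ∑ k ∈ Finset.range r, (1 - avgOp hδ 0) ^ k := by
  have h := mul_neg_geom_sum (1 - avgOp hδ 0) r
  rw [sub_sub_cancel] at h
  rw [h, sub_sub_cancel]

theorem opBound_sum_one_sub_avgOp_pow (hδ : 0 < δ) (r : ℕ) :
    OpBound δ (∑ k ∈ Finset.range r, (1 - avgOp hδ 0) ^ k) (32 / 21 * (7 / 4) ^ r) r := by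
  refine (OpBound.sum (Finset.range r) hδ fun k hk => (opBound_one_sub_avgOp_pow hδ k).mono hδ
    le_rfl (Finset.mem_range.1 hk).le).mono hδ ?_ le_rfl
  rw [← NNReal.coe_le_coe]; push_cast
  rw [← Finset.mul_sum, geom_sum_eq (by norm_num)]
  have : (0 : ℝ) ≤ (7 / 4) ^ r := by positivity
  rw [mul_div_assoc', div_le_iff₀ (by norm_num)]
  linarith

end Algebra

/-! ### Dividing differences by 1 - T with a Neumann series -/

section Neumann

variable {δ : ℝ}

/-- The contraction whose Neumann series inverts `1 - T` on differences. -/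
def contractionOp (hδ : 0 < δ) : Module.End ℝ LocInt :=
  (1 - (2 : ℝ) • avgOp hδ 1) * avgOp hδ 0

theorem avgOp_one_mul_shiftOp_sub_one (hδ : 0 < δ) :
    avgOp hδ 1 * (shiftOp δ - 1) = avgOp hδ 0 * avgOp hδ 0 - avgOp hδ 0 := by
  have h := avgOp_succ_mul_shiftOp_sub_one hδ 0
  simpa using h

/-- This form shows the smallness: A_2 has mass 1/6 and S - 1 mass 2, giving 2 · 1/6 · 2 = 2/3. -/
theorem contractionOp_eq (hδ : 0 < δ) :
    contractionOp hδ = -((2 : NNReal) : ℝ) • (avgOp hδ 2 * (shiftOp δ - 1)) := by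
  have h := avgOp_succ_mul_shiftOp_sub_one hδ 1
  rw [h, contractionOp, sub_mul, smul_mul_assoc, smul_sub, smul_smul, one_mul]
  norm_num
  abel

theorem opBound_shiftOp_sub_one (hδ : 0 < δ) : OpBound δ (shiftOp δ - 1) 2 1 :=
  ((opBound_shiftOp hδ).sub (opBound_one.mono hδ le_rfl zero_le_one)).mono hδ
    (by norm_num) le_rfl

theorem opBound_contractionOp (hδ : 0 < δ) : OpBound δ (contractionOp hδ) (2 / 3) 2 := by
  rw [contractionOp_eq, neg_smul]
  refine ((((opBound_avgOp hδ 2).mul (opBound_shiftOp_sub_one hδ)).nsmul 2).neg).mono hδ ?_ le_rfl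
  rw [← NNReal.coe_le_coe]; push_cast
  simp only [Nat.factorial]
  norm_num

theorem weightBound_contractionOp (hδ : 0 < δ) :
    WeightBound δ weightBase (contractionOp hδ) (37 / 50) :=
  (opBound_contractionOp hδ).weightBound (by
    -- The reach is 2, so the weighted mass is (2/3)(21/20)² = 0.735, still below 37/50.
    rw [weightBase, ← NNReal.coe_le_coe]; push_cast; norm_num)

theorem weightBound_shiftOp_sub_one (hδ : 0 < δ) :
    WeightBound δ weightBase (shiftOp δ - 1) (41 / 20) := by
  have h := ((opBound_shiftOp hδ).weightBound (ρ := weightBase) le_rfl).add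
    ((opBound_one (δ := δ)).neg.weightBound (ρ := weightBase) le_rfl)
  rw [← sub_eq_add_neg] at h
  exact h.mono (by rw [weightBase, ← NNReal.coe_le_coe]; push_cast; norm_num)

theorem weightBound_one_sub_avgOp (hδ : 0 < δ) :
    WeightBound δ weightBase (1 - avgOp hδ 0) (41 / 20) := by
  have h := ((opBound_one (δ := δ)).weightBound (ρ := weightBase) le_rfl).add
    ((opBound_avgOp hδ 0).neg.weightBound (ρ := weightBase) le_rfl)
  rw [← sub_eq_add_neg] at h
  exact h.mono (by rw [weightBase, ← NNReal.coe_le_coe]; push_cast; norm_num)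

theorem shiftOp_sub_one_eq (hδ : 0 < δ) :
    shiftOp δ - 1 = (shiftOp δ - 1 - (2 : ℝ) • (avgOp hδ 0 * avgOp hδ 0)) * (1 - avgOp hδ 0) +
      contractionOp hδ * (shiftOp δ - 1) := by
  have h := avgOp_one_mul_shiftOp_sub_one hδ
  have hc : avgOp hδ 0 * (shiftOp δ - 1) = (shiftOp δ - 1) * avgOp hδ 0 :=
    ((commute_shiftOp hδ 0).sub_left (Commute.one_left _)).symm
  have h2 : contractionOp hδ * (shiftOp δ - 1) = (shiftOp δ - 1) * avgOp hδ 0 -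
      (2 : ℝ) • ((avgOp hδ 0 * avgOp hδ 0 - avgOp hδ 0) * avgOp hδ 0) := by
    rw [contractionOp, mul_assoc, hc, ← h, sub_mul, one_mul, smul_mul_assoc, mul_assoc]
  rw [h2, two_smul, two_smul]
  noncomm_ring

/-- Partial sums of the Neumann series for `(S - 1) (1 - T)⁻¹`. -/
def neumannOp (hδ : 0 < δ) (N : ℕ) : Module.End ℝ LocInt :=
  (∑ n ∈ Finset.range N, contractionOp hδ ^ n) *
    (shiftOp δ - 1 - (2 : ℝ) • (avgOp hδ 0 * avgOp hδ 0))

theorem shiftOp_sub_one_eq_neumannOp (hδ : 0 < δ) (N : ℕ) :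
    shiftOp δ - 1 = neumannOp hδ N * (1 - avgOp hδ 0) +
      contractionOp hδ ^ N * (shiftOp δ - 1) := by
  have h := shiftOp_sub_one_eq hδ
  have h1 : (1 - contractionOp hδ) * (shiftOp δ - 1) =
      (shiftOp δ - 1 - (2 : ℝ) • (avgOp hδ 0 * avgOp hδ 0)) * (1 - avgOp hδ 0) := by
    rw [sub_mul, one_mul, sub_eq_iff_eq_add]; exact h
  rw [neumannOp, mul_assoc, ← h1, ← mul_assoc, geom_sum_mul_neg, sub_mul, one_mul,
    sub_add_cancel]

theorem weightBound_neumannOp (hδ : 0 < δ) (N : ℕ) :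
    WeightBound δ weightBase (neumannOp hδ N) (17) := by
  have h1 : WeightBound δ weightBase (∑ n ∈ Finset.range N, contractionOp hδ ^ n) (50 / 13) := by
    refine (WeightBound.sum (Finset.range N) fun n _ =>
      (weightBound_contractionOp hδ).pow n).mono ?_
    rw [← NNReal.coe_le_coe]; push_cast
    rw [geom_sum_eq (by norm_num)]
    have : (0 : ℝ) ≤ (37 / 50) ^ N := by positivity
    rw [div_le_iff_of_neg (by norm_num)]
    linarith
  have h2 := (((opBound_avgOp hδ 0).mul (opBound_avgOp hδ 0)).nsmul 2).neg.weightBound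
    (ρ := weightBase) le_rfl
  have h3 := (weightBound_shiftOp_sub_one hδ).add h2
  rw [← sub_eq_add_neg] at h3
  -- (50/13) · (41/20 + 2(21/20)²) is about 16.4, whatever the number of terms.
  refine (h1.mul h3).mono ?_
  rw [weightBase, ← NNReal.coe_le_coe]; push_cast
  norm_num

theorem commute_avgOp_contractionOp (hδ : 0 < δ) : Commute (avgOp hδ 0) (contractionOp hδ) :=
  ((Commute.one_right _).sub_right ((commute_avgOp hδ 1).symm.smul_right 2)).mul_right
    (Commute.refl _)

theorem commute_avgOp_shiftOp_sub_one (hδ : 0 < δ) : Commute (avgOp hδ 0) (shiftOp δ - 1) :=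
  (commute_shiftOp hδ 0).symm.sub_right (Commute.one_right _)

theorem commute_avgOp_neumannOp (hδ : 0 < δ) (N : ℕ) : Commute (avgOp hδ 0) (neumannOp hδ N) :=
  (Commute.sum_right _ _ _ fun n _ => (commute_avgOp_contractionOp hδ).pow_right n).mul_right
    ((commute_avgOp_shiftOp_sub_one hδ).sub_right
      (((Commute.refl _).mul_right (Commute.refl _)).smul_right 2))

/-- Differences are controlled by powers of `1 - T` up to an arbitrarily small error. -/
theorem exists_weightBound_difference (hδ : 0 < δ) (r : ℕ) : ∃ K : NNReal, ∀ N : ℕ,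
    WeightBound δ weightBase
      ((shiftOp δ - 1) ^ r - neumannOp hδ N ^ r * (1 - avgOp hδ 0) ^ r) (K * (37 / 50) ^ N) := by
  -- 17 · 41/20 bounds the product of the partial sum and 1 - T for every N, so `K` does not depend
  -- on N.
  obtain ⟨K, hK⟩ := exists_weightBound_pow_sub_pow (shiftOp δ - 1) (weightBound_shiftOp_sub_one hδ)
    (17 * (41 / 20)) r
  refine ⟨K * (41 / 20), fun N => ?_⟩
  have h := hK (neumannOp hδ N * (1 - avgOp hδ 0)) ((37 / 50) ^ N * (41 / 20))
    ((weightBound_neumannOp hδ N).mul (weightBound_one_sub_avgOp hδ)) ?_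
  · have hc : Commute (neumannOp hδ N) (1 - avgOp hδ 0) :=
      (Commute.one_right _).sub_right (commute_avgOp_neumannOp hδ N).symm
    rw [hc.mul_pow] at h
    exact h.mono (le_of_eq (by ring))
  · have e : shiftOp δ - 1 - neumannOp hδ N * (1 - avgOp hδ 0) =
        contractionOp hδ ^ N * (shiftOp δ - 1) :=
      sub_eq_of_eq_add' (shiftOp_sub_one_eq_neumannOp hδ N)
    rw [e]
    exact ((weightBound_contractionOp hδ).pow N).mul (weightBound_shiftOp_sub_one hδ)

end Neumann

/-! ### Modulus bounded by the K-functional -/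

section Direct

variable {p : ℝ → ℝ} {c₁ c₂ δ : ℝ}

theorem one_le_avgConst (hp : IsPLog p c₁ c₂) : 1 ≤ avgConst (max c₁ c₂) := by
  have h : 1 ≤ Real.exp (4 * max c₁ c₂) := Real.one_le_exp (by
    have := hp.pos₁.le.trans (le_max_left c₁ c₂); positivity)
  unfold avgConst
  linarith

theorem coe_one_sub_avgOp (hδ : 0 < δ) (f : LocInt) :
    (((1 - avgOp hδ 0) f : LocInt) : ℝ → ℝ) = fun x => (f : ℝ → ℝ) x - steklov δ f x := by
  rw [← coe_avgOp_zero hδ f]; rfl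

theorem steklovDiff_eq (hδ : 0 < δ) (r : ℕ) (f : LocInt) :
    steklovDiff r δ f = (((1 - avgOp hδ 0) ^ r) f : LocInt) := by
  induction r with
  | zero => rfl
  | succ r ih =>
    have e : steklovDiff (r + 1) δ f =
        fun x => steklovDiff r δ f x - steklov δ (steklovDiff r δ f) x := by
      simp only [steklovDiff]
      rw [Function.iterate_succ_apply']
    rw [e, ih, pow_succ', Module.End.mul_apply, coe_one_sub_avgOp]

theorem IsPLog.luxNorm_one_sub_avgOp_pow_le (hp : IsPLog p c₁ c₂) (hδ : 0 < δ) (r : ℕ)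
    (f : LocInt) :
    luxNorm p (((1 - avgOp hδ 0) ^ r) f : LocInt) ≤
      ENNReal.ofReal (12 * avgConst (max c₁ c₂) * 2 ^ r) * luxNorm p f := by
  set D := avgConst (max c₁ c₂) with hD
  have hD1 : 1 ≤ D := one_le_avgConst hp
  set W := ∑ k ∈ Finset.range r, (1 - avgOp hδ 0) ^ k with hW
  have hb := (opBound_sum_one_sub_avgOp_pow hδ r)
  have e : (((1 - avgOp hδ 0) ^ r) f : LocInt) = fun x =>
      (f : ℝ → ℝ) x + (-1) * ((avgOp hδ 0 * W) f : ℝ → ℝ) x := by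
    rw [one_sub_avgOp_pow_eq hδ r]
    funext x
    rw [neg_one_mul, ← sub_eq_add_neg]
    rfl
  rw [e]
  refine (luxNorm_add_le hp.measurable hp.one_le f.aemeasurable).trans ?_
  have h1 := (luxNorm_const_mul_le hp.one_le (-1) ((avgOp hδ 0 * W) f : ℝ → ℝ)).trans
    (mul_le_mul' le_rfl (hp.luxNorm_avgOp_mul_le hδ hb 0 f))
  refine (add_le_add le_rfl h1).trans ?_
  -- Bernoulli gives r + 1 ≤ 7(8/7)^r, and (7/4)(8/7) = 2. The constant is 32/3 ≤ 11; the identity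
  -- term raises it to 12.
  have h2 : ((32 / 21 * (7 / 4) ^ r * (r + 1) : NNReal) : ℝ) ≤ 11 * 2 ^ r := by
    push_cast
    have hB := one_add_mul_le_pow (a := (1 / 7 : ℝ)) (by norm_num) r
    have h3 : (r + 1 : ℝ) ≤ 7 * (8 / 7) ^ r := by
      have : (1 + 1 / 7 : ℝ) = 8 / 7 := by norm_num
      rw [this] at hB
      linarith
    have h4 : (7 / 4 : ℝ) ^ r * (8 / 7) ^ r = 2 ^ r := by
      rw [← mul_pow]; norm_num
    calc (32 / 21 * (7 / 4) ^ r * (r + 1) : ℝ) ≤ 32 / 21 * (7 / 4) ^ r * (7 * (8 / 7) ^ r) := by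
          gcongr
      _ = 32 / 3 * ((7 / 4 : ℝ) ^ r * (8 / 7) ^ r) := by ring
      _ ≤ _ := by rw [h4]; have : (0 : ℝ) < 2 ^ r := by positivity
                  linarith
  have h5 : (1 : ℝ) ≤ 2 ^ r := one_le_pow₀ (by norm_num)
  calc _ = (ENNReal.ofReal 1 + ENNReal.ofReal |-1| *
        (ENNReal.ofReal ((32 / 21 * (7 / 4) ^ r * (r + 1) : NNReal) : ℝ) * ENNReal.ofReal D)) *
          luxNorm p f := by
        rw [ENNReal.ofReal_coe_nnreal, ENNReal.ofReal_one]; ring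
    _ ≤ _ := by
        refine mul_le_mul' ?_ le_rfl
        rw [← ENNReal.ofReal_mul (by positivity), ← ENNReal.ofReal_mul (by positivity),
          ← ENNReal.ofReal_add (by positivity) (by positivity)]
        refine ENNReal.ofReal_le_ofReal ?_
        rw [abs_neg, abs_one, one_mul]
        have h6 := mul_le_mul_of_nonneg_right h2 (by positivity : 0 ≤ D)
        have h7 : 1 ≤ D * 2 ^ r := one_le_mul_of_one_le_of_one_le hD1 h5
        linarith

theorem locallyIntegrable_of_intervalIntegrable {u : ℝ → ℝ}
    (h : ∀ a b, IntervalIntegrable u volume a b) : LocallyIntegrable u := fun x =>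
  ⟨Set.Ioc (x - 1) (x + 1), Ioc_mem_nhds (by linarith) (by linarith),
    (intervalIntegrable_iff_integrableOn_Ioc_of_le (by linarith)).1 (h _ _)⟩

theorem isPrimitive_deriv_of_absolutelyContinuous {u : ℝ → ℝ}
    (h : ∀ a b, AbsolutelyContinuousOnInterval u a b) : IsPrimitive u (deriv u) :=
  ⟨locallyIntegrable_of_intervalIntegrable fun _ _ => (h _ _).intervalIntegrable_deriv,
    fun _ _ => (h _ _).integral_deriv_eq_sub⟩

theorem isPrimitive_deriv_of_continuous {u : ℝ → ℝ} (h : Differentiable ℝ u)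
    (h' : Continuous (deriv u)) : IsPrimitive u (deriv u) :=
  ⟨h'.locallyIntegrable, fun _ _ => intervalIntegral.integral_eq_sub_of_hasDerivAt
    (fun x _ => (h x).hasDerivAt) (h'.intervalIntegrable _ _)⟩

theorem continuous_of_absolutelyContinuous {u : ℝ → ℝ}
    (h : ∀ a b, AbsolutelyContinuousOnInterval u a b) : Continuous u :=
  (isPrimitive_deriv_of_absolutelyContinuous h).continuous

theorem InSobolev.isPrimitive {r : ℕ} {g : ℝ → ℝ} (hg : InSobolev p r g) {k : ℕ} (hk : k < r) :
    IsPrimitive (iteratedDeriv k g) (iteratedDeriv (k + 1) g) := by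
  rw [iteratedDeriv_succ]
  -- Only the top step needs absolute continuity. Below it the next derivative is continuous and the
  -- classical fundamental theorem applies.
  rcases (show k + 1 = r ∨ k + 1 < r by omega) with h | h
  · have : k = r - 1 := by omega
    subst this
    exact isPrimitive_deriv_of_absolutelyContinuous hg.absCont
  · refine isPrimitive_deriv_of_continuous (hg.differentiable k h) ?_
    rw [← iteratedDeriv_succ]
    rcases (show k + 1 = r - 1 ∨ k + 1 + 1 < r by omega) with h' | h'
    · rw [h']; exact continuous_of_absolutelyContinuous hg.absCont
    · exact (hg.differentiable _ h').continuous

theorem IsPrimitive.one_sub_avgOp (hδ : 0 < δ) {u v : LocInt}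
    (h : IsPrimitive (u : ℝ → ℝ) (v : ℝ → ℝ)) : (1 - avgOp hδ 0) u = -δ • avgOp hδ 1 v := by
  have e := h.avgOp_succ hδ 0
  rw [zero_add] at e
  rw [e, smul_smul, neg_mul, mul_inv_cancel₀ hδ.ne', LinearMap.sub_apply, Module.End.one_apply]
  simp

theorem exists_locInt {u : ℝ → ℝ} (hu : LocallyIntegrable u) : ∃ f : LocInt, (f : ℝ → ℝ) = u :=
  ⟨⟨u, hu⟩, rfl⟩

/-- Each factor 1 - T costs one derivative and yields -δ A_1. Commutation of T with A_1 lets the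
next factor reach the function. -/
theorem InSobolev.one_sub_avgOp_pow (hδ : 0 < δ) {r : ℕ}
    {g : LocInt} (hg : InSobolev p r g) : ∀ k ≤ r, ∃ v : LocInt,
      (v : ℝ → ℝ) = iteratedDeriv k g ∧
      ((1 - avgOp hδ 0) ^ k) g = (-δ) ^ k • (avgOp hδ 1 ^ k) v := by
  intro k
  induction k with
  | zero => exact fun _ => ⟨g, by rw [iteratedDeriv_zero], by simp⟩
  | succ k ih =>
    intro hk
    obtain ⟨u, hu, hu'⟩ := ih (by omega)
    have hprim := hg.isPrimitive (show k < r by omega)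
    obtain ⟨v, hv⟩ := exists_locInt hprim.locallyIntegrable
    rw [← hu, ← hv] at hprim
    refine ⟨v, hv, ?_⟩
    have hc : Commute (1 - avgOp hδ 0) (avgOp hδ 1 ^ k) :=
      ((Commute.one_left _).sub_left (commute_avgOp hδ 1).symm).pow_right k
    have hc' : (1 - avgOp hδ 0) ((avgOp hδ 1 ^ k) u) =
        (avgOp hδ 1 ^ k) ((1 - avgOp hδ 0) u) := LinearMap.congr_fun hc u
    rw [pow_succ' (1 - avgOp hδ 0), Module.End.mul_apply, hu', map_smul, hc',
      hprim.one_sub_avgOp hδ, map_smul, smul_smul, ← pow_succ, pow_succ (avgOp hδ 1),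
      Module.End.mul_apply]

theorem InSobolev.luxNorm_one_sub_avgOp_pow_le (hp : IsPLog p c₁ c₂) (hδ : 0 < δ) {r : ℕ}
    (hr : 1 ≤ r) {g : LocInt} (hg : InSobolev p r g) :
    luxNorm p (((1 - avgOp hδ 0) ^ r) g : LocInt) ≤
      ENNReal.ofReal (avgConst (max c₁ c₂)) *
        (ENNReal.ofReal (δ ^ r) * luxNorm p (iteratedDeriv r g)) := by
  obtain ⟨v, hv, e⟩ := hg.one_sub_avgOp_pow hδ r le_rfl
  obtain ⟨s, rfl⟩ := Nat.exists_eq_add_of_le' hr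
  rw [e, ← hv]
  have hb : OpBound δ (avgOp hδ 1 ^ s) ((1 / 2) ^ s) s := by
    have := (opBound_avgOp hδ 1).pow s
    simpa using this
  have h1 := hp.luxNorm_avgOp_mul_le hδ hb 1 v
  -- One of the `s + 1` factors A_1 does the averaging; the halved masses of the others beat the
  -- reach factor.
  have h2 : ((1 / 2) ^ s * (s + 1) : NNReal) ≤ 1 := by
    rw [← NNReal.coe_le_coe]; push_cast
    have h3 : ((s + 1 : ℕ) : ℝ) ≤ ((2 ^ s : ℕ) : ℝ) := by exact_mod_cast s.lt_two_pow_self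
    push_cast at h3
    rw [div_pow, one_pow, div_mul_eq_mul_div, one_mul, div_le_one (by positivity)]
    exact h3
  have h4 : luxNorm p ((avgOp hδ 1 ^ (s + 1)) v : LocInt) ≤
      ENNReal.ofReal (avgConst (max c₁ c₂)) * luxNorm p v := by
    rw [pow_succ']
    exact h1.trans (mul_le_of_le_one_left' (by exact_mod_cast h2))
  refine (luxNorm_const_mul_le hp.one_le ((-δ) ^ (s + 1)) _).trans ?_
  rw [abs_pow, abs_neg, abs_of_pos hδ, mul_left_comm]
  exact mul_le_mul' le_rfl h4

theorem modulus_le_kFunctional (hp : IsPLog p c₁ c₂) (hδ : 0 < δ) {r : ℕ} (hr : 1 ≤ r)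
    (f : LocInt) :
    modulus p r f δ ≤
      ENNReal.ofReal (12 * avgConst (max c₁ c₂) * 2 ^ r) * kFunctional p r f δ := by
  have hD1 := one_le_avgConst hp
  have hK0 : 0 < 12 * avgConst (max c₁ c₂) * 2 ^ r := by positivity
  rw [kFunctional, ENNReal.mul_iInf_of_ne (by simpa using hK0) ENNReal.ofReal_ne_top]
  refine le_iInf fun g => ?_
  rw [ENNReal.mul_iInf_of_ne (by simpa using hK0) ENNReal.ofReal_ne_top]
  refine le_iInf fun hg => ?_
  obtain ⟨g, rfl⟩ := exists_locInt (hg.memLp.locallyIntegrable hp.measurable hp.one_le)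
  rw [modulus, steklovDiff_eq hδ]
  have e : (((1 - avgOp hδ 0) ^ r) f : LocInt) = fun x =>
      (((1 - avgOp hδ 0) ^ r) (f - g) : ℝ → ℝ) x + (((1 - avgOp hδ 0) ^ r) g : ℝ → ℝ) x := by
    conv_lhs => rw [← sub_add_cancel f g, map_add]
    rfl
  rw [e, mul_add]
  refine (luxNorm_add_le hp.measurable hp.one_le (LocInt.aemeasurable _)).trans ?_
  refine add_le_add (hp.luxNorm_one_sub_avgOp_pow_le hδ r (f - g)) ?_
  refine (hg.luxNorm_one_sub_avgOp_pow_le hp hδ hr).trans (mul_le_mul' ?_ le_rfl)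
  refine ENNReal.ofReal_le_ofReal ?_
  have : (1 : ℝ) ≤ 2 ^ r := one_le_pow₀ (by norm_num)
  nlinarith

/-- The competitor is g = 0. -/
theorem kFunctional_lt_top (hp : IsPLog p c₁ c₂) {r : ℕ} {f : ℝ → ℝ} (hf : InLp p f) :
    kFunctional p r f δ < ∞ := by
  have hz : InLp p fun _ => 0 := by
    refine (inLp_iff hp.one_le).2 ⟨aemeasurable_const, ?_⟩
    have := luxNorm_const_mul_le hp.one_le 0 (fun _ => 0)
    simp only [zero_mul, abs_zero, ENNReal.ofReal_zero] at this
    exact this.trans_lt ENNReal.zero_lt_top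
  have hd : ∀ k, iteratedDeriv k (fun _ : ℝ => (0 : ℝ)) = fun _ => 0 := fun k => by
    funext x; simp
  have hs : InSobolev p r fun _ => 0 := by
    refine ⟨hz, fun k _ => ?_, fun a b => ?_, ?_⟩
    · rw [hd]; exact differentiable_const 0
    · rw [hd]; exact (LipschitzWith.const (0 : ℝ)).lipschitzOnWith.absolutelyContinuousOnInterval
    · rw [hd]; exact hz
  refine (iInf₂_le (fun _ => 0) hs).trans_lt ?_
  rw [hd]
  simp only [sub_zero]
  exact ENNReal.add_lt_top.2 ⟨((inLp_iff hp.one_le).1 hf).2,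
    ENNReal.mul_lt_top ENNReal.ofReal_lt_top ((inLp_iff hp.one_le).1 hz).2⟩

end Direct

/-! ### K-functional bounded by the modulus -/

section Converse

variable {p : ℝ → ℝ} {c₁ c₂ δ : ℝ}

theorem continuous_avgOp (hδ : 0 < δ) (n : ℕ) (f : LocInt) :
    Continuous (avgOp hδ n f : ℝ → ℝ) := continuous_taylorAvg hδ n f.locallyIntegrable

theorem continuous_difference_pow {f : LocInt} (hf : Continuous (f : ℝ → ℝ)) (k : ℕ) :
    Continuous (((shiftOp δ - 1) ^ k) f : ℝ → ℝ) := by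
  induction k with
  | zero => exact hf
  | succ k ih =>
    rw [pow_succ', Module.End.mul_apply]
    exact (ih.comp (continuous_add_const δ)).sub ih

theorem continuous_avgOp_pow (hδ : 0 < δ) {f : LocInt} (hf : Continuous (f : ℝ → ℝ)) (k : ℕ) :
    Continuous ((avgOp hδ 0 ^ k) f : ℝ → ℝ) := by
  cases k with
  | zero => exact hf
  | succ k =>
    rw [pow_succ', Module.End.mul_apply]
    exact continuous_avgOp hδ 0 _

theorem hasDerivAt_avgOp (hδ : 0 < δ) {f : LocInt} (hf : Continuous (f : ℝ → ℝ)) (x : ℝ) :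
    HasDerivAt (avgOp hδ 0 f : ℝ → ℝ) (δ⁻¹ * ((shiftOp δ - 1) f : ℝ → ℝ) x) x := by
  have h := isPrimitive_avgOp_zero hδ f
  rw [funext h.eq_add_integral]
  have hc : Continuous ((δ⁻¹ • (shiftOp δ f - f) : LocInt) : ℝ → ℝ) :=
    ((hf.comp (continuous_add_const δ)).sub hf).const_smul δ⁻¹
  exact (intervalIntegral.integral_hasDerivAt_right (hc.intervalIntegrable _ _)
    hc.stronglyMeasurable.stronglyMeasurableAtFilter hc.continuousAt).const_add _

theorem commute_difference_pow (hδ : 0 < δ) (k : ℕ) (f : LocInt) :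
    ((shiftOp δ - 1) ^ k) (avgOp hδ 0 f) = avgOp hδ 0 (((shiftOp δ - 1) ^ k) f) :=
  (LinearMap.congr_fun ((commute_avgOp_shiftOp_sub_one hδ).pow_right k) f).symm

/-- Each factor T absorbs one derivative and turns it into δ⁻¹(S-1). Continuity of f makes every
derivative classical, so the formula holds everywhere. -/
theorem iteratedDeriv_avgOp_pow (hδ : 0 < δ) {f : LocInt} (hf : Continuous (f : ℝ → ℝ)) (k m : ℕ) :
    iteratedDeriv k ((avgOp hδ 0 ^ (k + m)) f : ℝ → ℝ) =
      fun x => δ⁻¹ ^ k * (((shiftOp δ - 1) ^ k) ((avgOp hδ 0 ^ m) f) : ℝ → ℝ) x := by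
  induction k generalizing m with
  | zero => funext x; simp
  | succ k ih =>
    rw [iteratedDeriv_succ, show k + 1 + m = k + (m + 1) by ring, ih (m + 1), pow_succ' (avgOp hδ 0),
      Module.End.mul_apply, commute_difference_pow, pow_succ' (shiftOp δ - 1), Module.End.mul_apply]
    funext x
    have hc := continuous_difference_pow (δ := δ) (continuous_avgOp_pow hδ hf m) k
    rw [((hasDerivAt_avgOp hδ hc x).const_mul (δ⁻¹ ^ k)).deriv, pow_succ, mul_assoc]

/-- The combination of averages in the smooth approximant. -/
def approxSum (hδ : 0 < δ) (r : ℕ) : Module.End ℝ LocInt :=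
  ∑ i ∈ Finset.range r, (1 - avgOp hδ 0 ^ (r + 1)) ^ i

theorem opBound_approxSum (hδ : 0 < δ) (r : ℕ) :
    OpBound δ (approxSum hδ r) (2 ^ r) (r * (r + 1)) := by
  have h0 : OpBound δ (1 - avgOp hδ 0 ^ (r + 1)) 2 (r + 1) := by
    have h1 := (opBound_avgOp hδ 0).pow (r + 1)
    rw [mul_one] at h1
    exact ((opBound_one.mono hδ le_rfl (Nat.zero_le _)).sub h1).mono hδ
      (by simp; norm_num) le_rfl
  refine (OpBound.sum (Finset.range r) hδ fun i hi => (h0.pow i).mono hδ le_rfl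
    (Nat.mul_le_mul_right _ (Finset.mem_range.1 hi).le)).mono hδ ?_ le_rfl
  rw [← NNReal.coe_le_coe]; push_cast
  rw [geom_sum_eq (by norm_num)]
  norm_num

theorem one_sub_pow_eq_approxSum (hδ : 0 < δ) (r : ℕ) :
    1 - (1 - avgOp hδ 0 ^ (r + 1)) ^ r = avgOp hδ 0 ^ (r + 1) * approxSum hδ r := by
  have h := mul_neg_geom_sum (1 - avgOp hδ 0 ^ (r + 1)) r
  rw [sub_sub_cancel] at h
  exact h.symm

theorem sq_add_self_add_one_le (r : ℕ) (hr : 1 ≤ r) : r * (r + 1) + 1 ≤ 2 * 2 ^ r := by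
  induction r, hr using Nat.le_induction with
  | base => norm_num
  | succ n hn ih =>
    rcases (show n = 1 ∨ 2 ≤ n by omega) with rfl | h
    · norm_num
    · rw [pow_succ]; nlinarith

theorem succ_pow_le_three_mul_pow (r : ℕ) (hr : 1 ≤ r) : ((r : ℝ) + 1) ^ r ≤ 3 * (r : ℝ) ^ r := by
  have hr0 : (0 : ℝ) < r := by exact_mod_cast hr
  have h1 : (r : ℝ) + 1 ≤ r * Real.exp (1 / r) := by
    calc (r : ℝ) + 1 = r * (1 / r + 1) := by field_simp; ring
      _ ≤ _ := by gcongr; exact Real.add_one_le_exp _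
  calc ((r : ℝ) + 1) ^ r ≤ (r * Real.exp (1 / r)) ^ r := by gcongr
    _ = (r : ℝ) ^ r * Real.exp 1 := by
      rw [mul_pow, ← Real.exp_nat_mul, mul_one_div_cancel hr0.ne']
    _ ≤ _ := by
      have : Real.exp 1 ≤ 3 := by linarith [Real.exp_one_lt_d9]
      have h2 : (0 : ℝ) ≤ (r : ℝ) ^ r := by positivity
      nlinarith

/-- The error operator factors through `(1 - T)^r` up to one extra average. -/
theorem exists_error_factorization (hδ : 0 < δ) (r : ℕ) : ∃ Z : Module.End ℝ LocInt,
    OpBound δ Z ((r + 1) ^ r) (r * (r + 1)) ∧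
      (1 - avgOp hδ 0 ^ (r + 1)) ^ r = (1 + avgOp hδ 0 * Z) * (1 - avgOp hδ 0) ^ r := by
  set T := avgOp hδ 0 with hT
  set P := ∑ k ∈ Finset.range (r + 1), T ^ k with hP
  set W := ∑ k ∈ Finset.range r, T ^ k with hW
  have hTk : ∀ k, OpBound δ (T ^ k) 1 k := fun k => by
    simpa using (opBound_avgOp hδ 0).pow k
  have hWb : OpBound δ W r r := by
    have := OpBound.sum (Finset.range r) hδ fun k hk =>
      (hTk k).mono hδ le_rfl (Finset.mem_range.1 hk).le
    simpa using this
  have hPb : OpBound δ P (r + 1) r := by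
    have := OpBound.sum (Finset.range (r + 1)) hδ fun k hk =>
      (hTk k).mono hδ le_rfl (Nat.lt_succ_iff.1 (Finset.mem_range.1 hk))
    simpa using this
  have hSb : OpBound δ (∑ i ∈ Finset.range r, P ^ i)
      (∑ i ∈ Finset.range r, ((r : NNReal) + 1) ^ i) (r * r) :=
    OpBound.sum (Finset.range r) hδ fun i hi =>
      (hPb.pow i).mono hδ le_rfl (Nat.mul_le_mul_right _ (Finset.mem_range.1 hi).le)
  -- From 1 - T^{r+1} = P(1-T) and P - 1 = TW, the geometric sum gives P^r = 1 + TW∑P^i. The mass is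
  -- r∑(r+1)^i = (r+1)^r - 1, the reach r + r·r.
  refine ⟨W * ∑ i ∈ Finset.range r, P ^ i, (hWb.mul hSb).mono hδ ?_ (by nlinarith), ?_⟩
  · rw [← NNReal.coe_le_coe]; push_cast
    have := mul_geom_sum ((r : ℝ) + 1) r
    rw [add_sub_cancel_right] at this
    rw [this]
    linarith
  · have hPW : P - 1 = T * W := by
      rw [hP, geom_sum_succ, add_sub_cancel_right]
    have h1 : 1 + T * (W * ∑ i ∈ Finset.range r, P ^ i) = P ^ r := by
      rw [← mul_assoc, ← hPW, mul_geom_sum, add_sub_cancel]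
    have h2 : 1 - T ^ (r + 1) = P * (1 - T) := (geom_sum_mul_neg T (r + 1)).symm
    have hc : Commute P (1 - T) :=
      (Commute.one_right _).sub_right
        (Commute.sum_left _ _ _ fun k _ => (Commute.refl T).pow_left k)
    rw [h1, h2, hc.mul_pow]

theorem IsPLog.luxNorm_error_le (hp : IsPLog p c₁ c₂) (hδ : 0 < δ) {r : ℕ} (hr : 1 ≤ r)
    (f : LocInt) :
    luxNorm p (((1 - avgOp hδ 0 ^ (r + 1)) ^ r) f : LocInt) ≤
      ENNReal.ofReal (7 * avgConst (max c₁ c₂) * (2 * r) ^ r) *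
        luxNorm p (((1 - avgOp hδ 0) ^ r) f : LocInt) := by
  obtain ⟨Z, hZ, e⟩ := exists_error_factorization hδ r
  set h := ((1 - avgOp hδ 0) ^ r) f
  set D := avgConst (max c₁ c₂) with hD
  have hD1 : 1 ≤ D := one_le_avgConst hp
  have hr1 : (1 : ℝ) ≤ r := by exact_mod_cast hr
  have e' : (((1 - avgOp hδ 0 ^ (r + 1)) ^ r) f : LocInt) =
      fun x => (h : ℝ → ℝ) x + ((avgOp hδ 0 * Z) h : ℝ → ℝ) x := by rw [e]; rfl
  rw [e']
  refine (luxNorm_add_le hp.measurable hp.one_le h.aemeasurable).trans ?_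
  refine (add_le_add le_rfl (hp.luxNorm_avgOp_mul_le hδ hZ 0 h)).trans ?_
  -- The 3 (a bound for e) from (r+1)^r ≤ 3r^r times the 2 from the reach factor r(r+1) + 1 ≤ 2 ·
  -- 2^r.
  have h2 : (((r + 1) ^ r * ((r * (r + 1) : ℕ) + 1) : NNReal) : ℝ) ≤ 6 * (2 * r) ^ r := by
    have h3 : ((r * (r + 1) + 1 : ℕ) : ℝ) ≤ ((2 * 2 ^ r : ℕ) : ℝ) := by
      exact_mod_cast sq_add_self_add_one_le r hr
    push_cast at h3 ⊢
    calc ((r : ℝ) + 1) ^ r * (r * (r + 1) + 1) ≤ (3 * (r : ℝ) ^ r) * (2 * 2 ^ r) := by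
          gcongr
          exact succ_pow_le_three_mul_pow r hr
      _ = _ := by rw [mul_pow]; ring
  have h5 : (1 : ℝ) ≤ (2 * r) ^ r := one_le_pow₀ (by linarith)
  calc _ = (ENNReal.ofReal 1 + ENNReal.ofReal
        (((r + 1) ^ r * ((r * (r + 1) : ℕ) + 1) : NNReal) : ℝ) * ENNReal.ofReal D) *
          luxNorm p h := by
        rw [ENNReal.ofReal_coe_nnreal, ENNReal.ofReal_one]; ring
    _ ≤ _ := by
        refine mul_le_mul' ?_ le_rfl
        rw [← ENNReal.ofReal_mul (by positivity),
          ← ENNReal.ofReal_add (by positivity) (by positivity)]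
        refine ENNReal.ofReal_le_ofReal ?_
        have h6 := mul_le_mul_of_nonneg_right h2 (by positivity : 0 ≤ D)
        have h7 : 1 ≤ D * (2 * r) ^ r := one_le_mul_of_one_le_of_one_le hD1 h5
        linarith

/-- The `r`-th difference of the averaged approximant is controlled by `(1 - T)^r f`. -/
theorem IsPLog.luxNorm_difference_le (hp : IsPLog p c₁ c₂) (hδ : 0 < δ) {r : ℕ} (hr : 1 ≤ r)
    (f : LocInt) (hf : luxNorm p f < ∞) :
    luxNorm p (((shiftOp δ - 1) ^ r) (avgOp hδ 0 (approxSum hδ r f)) : LocInt) ≤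
      ENNReal.ofReal (40 * avgConst (max c₁ c₂) * 68 ^ r) *
        luxNorm p (((1 - avgOp hδ 0) ^ r) f : LocInt) := by
  set h := ((1 - avgOp hδ 0) ^ r) f with hh
  set D := avgConst (max c₁ c₂) with hD
  have hD1 : 1 ≤ D := one_le_avgConst hp
  obtain ⟨K, hK⟩ := exists_weightBound_difference hδ r
  set m : NNReal := 2 ^ r * ((r * (r + 1) : ℕ) + 1) * 20 with hm
  -- At every truncation level the main term has the same constant and the remainder is
  -- geometrically small, though it is measured by f instead of (1-T)^r f.
  have hN : ∀ N : ℕ, luxNorm p (((shiftOp δ - 1) ^ r) (avgOp hδ 0 (approxSum hδ r f)) : LocInt) ≤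
      (m * 17 ^ r : NNReal) * (ENNReal.ofReal D * luxNorm p h) +
        (m * (K * (37 / 50) ^ N) : NNReal) * (ENNReal.ofReal D * luxNorm p f) := by
    intro N
    set R := (shiftOp δ - 1) ^ r - neumannOp hδ N ^ r * (1 - avgOp hδ 0) ^ r with hR
    have hcA : Commute (shiftOp δ - 1) (approxSum hδ r) :=
      Commute.sum_right _ _ _ fun i _ => ((Commute.one_right _).sub_right
        ((commute_avgOp_shiftOp_sub_one hδ).symm.pow_right _)).pow_right i
    have hc : (shiftOp δ - 1) ^ r * (avgOp hδ 0 * approxSum hδ r) =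
        avgOp hδ 0 * approxSum hδ r * (shiftOp δ - 1) ^ r :=
      (((commute_avgOp_shiftOp_sub_one hδ).symm.mul_right hcA).pow_left r)
    have e1 : (shiftOp δ - 1) ^ r = neumannOp hδ N ^ r * (1 - avgOp hδ 0) ^ r + R :=
      (add_sub_cancel _ _).symm
    have e2 : (shiftOp δ - 1) ^ r * (avgOp hδ 0 * approxSum hδ r) =
        avgOp hδ 0 * approxSum hδ r * neumannOp hδ N ^ r * (1 - avgOp hδ 0) ^ r +
          avgOp hδ 0 * approxSum hδ r * R := by
      rw [hc, e1, mul_add, ← mul_assoc]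
    have e3 : (((shiftOp δ - 1) ^ r) (avgOp hδ 0 (approxSum hδ r f)) : LocInt) =
        fun x => ((avgOp hδ 0 * approxSum hδ r * neumannOp hδ N ^ r) h : ℝ → ℝ) x +
          ((avgOp hδ 0 * approxSum hδ r * R) f : ℝ → ℝ) x := by
      have := LinearMap.congr_fun e2 f
      rw [Module.End.mul_apply, Module.End.mul_apply] at this
      rw [this]
      rfl
    rw [e3]
    refine (luxNorm_add_le hp.measurable hp.one_le (LocInt.aemeasurable _)).trans ?_
    exact add_le_add
      (((weightBound_neumannOp hδ N).pow r).luxNorm_le hp hδ (opBound_approxSum hδ r) h)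
      ((hK N).luxNorm_le hp hδ (opBound_approxSum hδ r) f)
  have hlim : Tendsto (fun N : ℕ => (m * 17 ^ r : NNReal) * (ENNReal.ofReal D * luxNorm p h) +
        (m * (K * (37 / 50) ^ N) : NNReal) * (ENNReal.ofReal D * luxNorm p f)) atTop
      (nhds ((m * 17 ^ r : NNReal) * (ENNReal.ofReal D * luxNorm p h) +
        ((m * (K * 0) : NNReal) : ℝ≥0∞) * (ENNReal.ofReal D * luxNorm p f))) := by
    refine tendsto_const_nhds.add (ENNReal.Tendsto.mul_const ?_
      (Or.inr (ENNReal.mul_lt_top ENNReal.ofReal_lt_top hf).ne))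
    rw [ENNReal.tendsto_coe]
    have h37 : (37 / 50 : NNReal) < 1 := by rw [← NNReal.coe_lt_coe]; push_cast; norm_num
    have ht : Tendsto (fun N : ℕ => (37 / 50 : NNReal) ^ N) atTop (nhds 0) :=
      NNReal.tendsto_pow_atTop_nhds_zero_of_lt_one h37
    exact tendsto_const_nhds.mul (tendsto_const_nhds.mul ht)
  have hle := ge_of_tendsto' hlim hN
  rw [mul_zero, mul_zero, ENNReal.coe_zero, zero_mul, add_zero, ← mul_assoc] at hle
  refine hle.trans (mul_le_mul' ?_ le_rfl)
  rw [← ENNReal.ofReal_coe_nnreal, ← ENNReal.ofReal_mul (by positivity)]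
  refine ENNReal.ofReal_le_ofReal ?_
  have h3 : ((r * (r + 1) + 1 : ℕ) : ℝ) ≤ ((2 * 2 ^ r : ℕ) : ℝ) := by
    exact_mod_cast sq_add_self_add_one_le r hr
  push_cast at h3
  rw [hm]
  push_cast
  -- 68 = 2 · 2 · 17: the mass of `approxSum`, its reach, and the Neumann bound.
  calc (2 : ℝ) ^ r * (r * (r + 1) + 1) * 20 * 17 ^ r * D ≤
        2 ^ r * (2 * 2 ^ r) * 20 * 17 ^ r * D := by gcongr
    _ = 40 * D * (2 * 2 * 17) ^ r := by rw [mul_pow, mul_pow]; ring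
    _ = _ := by norm_num

theorem kFunctional_le_modulus (hp : IsPLog p c₁ c₂) (hδ : 0 < δ) {r : ℕ} (hr : 1 ≤ r)
    (f : LocInt) (hf : luxNorm p f < ∞) :
    kFunctional p r f δ ≤
      ENNReal.ofReal (40 * avgConst (max c₁ c₂) * ((2 * r) ^ r + 2 ^ r * 34 ^ r)) *
        modulus p r f δ := by
  set D := avgConst (max c₁ c₂) with hD
  have hD1 : 1 ≤ D := one_le_avgConst hp
  set h := ((1 - avgOp hδ 0) ^ r) f with hh
  set w := avgOp hδ 0 (approxSum hδ r f) with hw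
  have hwc : Continuous (w : ℝ → ℝ) := continuous_avgOp hδ 0 _
  -- Of the r + 1 averages in the approximant, r absorb derivatives; the one kept in `w` gives
  -- continuity and provides the averaging for the norm estimate.
  set g := (avgOp hδ 0 ^ r) w with hg
  have hmod : modulus p r f δ = luxNorm p h := by rw [modulus, steklovDiff_eq hδ]
  have hmod_top : luxNorm p h < ∞ :=
    (hp.luxNorm_one_sub_avgOp_pow_le hδ r f).trans_lt (ENNReal.mul_lt_top ENNReal.ofReal_lt_top hf)
  have hgf : g = f - ((1 - avgOp hδ 0 ^ (r + 1)) ^ r) f := by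
    have e := LinearMap.congr_fun (one_sub_pow_eq_approxSum hδ r) f
    rw [pow_succ (avgOp hδ 0), mul_assoc] at e
    exact e.symm
  have hfg : (fun x => (f : ℝ → ℝ) x - (g : ℝ → ℝ) x) =
      (((1 - avgOp hδ 0 ^ (r + 1)) ^ r) f : LocInt) := by
    have e : ((1 - avgOp hδ 0 ^ (r + 1)) ^ r) f = f - g := by rw [hgf, sub_sub_cancel]
    rw [e]; rfl
  have herr := hp.luxNorm_error_le hδ hr f
  have hdiff := hp.luxNorm_difference_le hδ hr f hf
  rw [← hh] at herr hdiff
  rw [← hw] at hdiff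
  have hder : iteratedDeriv r (g : ℝ → ℝ) =
      fun x => δ⁻¹ ^ r * (((shiftOp δ - 1) ^ r) w : ℝ → ℝ) x := by
    have := iteratedDeriv_avgOp_pow hδ hwc r 0
    simpa using this
  have hlow : ∀ k, k < r → ∃ v : LocInt, Continuous (v : ℝ → ℝ) ∧
      iteratedDeriv k (g : ℝ → ℝ) = fun x => δ⁻¹ ^ k * (avgOp hδ 0 v : ℝ → ℝ) x := by
    intro k hk
    obtain ⟨m, rfl⟩ := Nat.exists_eq_add_of_lt hk
    refine ⟨((shiftOp δ - 1) ^ k) ((avgOp hδ 0 ^ m) w),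
      continuous_difference_pow (continuous_avgOp_pow hδ hwc m) k, ?_⟩
    have := iteratedDeriv_avgOp_pow hδ hwc k (m + 1)
    rw [pow_succ' (avgOp hδ 0) m, Module.End.mul_apply, commute_difference_pow] at this
    exact this
  have hder_le : ENNReal.ofReal (δ ^ r) * luxNorm p (iteratedDeriv r (g : ℝ → ℝ)) ≤
      ENNReal.ofReal (40 * D * 68 ^ r) * luxNorm p h := by
    rw [hder]
    calc _ ≤ ENNReal.ofReal (δ ^ r) * (ENNReal.ofReal |δ⁻¹ ^ r| *
          luxNorm p (((shiftOp δ - 1) ^ r) w : LocInt)) :=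
          mul_le_mul' le_rfl (luxNorm_const_mul_le hp.one_le _ _)
      _ = luxNorm p (((shiftOp δ - 1) ^ r) w : LocInt) := by
          rw [← mul_assoc, ← ENNReal.ofReal_mul (by positivity), abs_of_nonneg (by positivity),
            ← mul_pow, mul_inv_cancel₀ hδ.ne', one_pow, ENNReal.ofReal_one, one_mul]
      _ ≤ _ := hdiff
  have hgSob : InSobolev p r (g : ℝ → ℝ) := by
    refine ⟨(inLp_iff hp.one_le).2 ⟨g.aemeasurable, ?_⟩, fun k hk => ?_, fun a b => ?_,
      (inLp_iff hp.one_le).2 ⟨?_, ?_⟩⟩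
    · have e : (g : ℝ → ℝ) = fun x => (f : ℝ → ℝ) x +
          (-1) * (((1 - avgOp hδ 0 ^ (r + 1)) ^ r) f : ℝ → ℝ) x := by
        rw [← hfg]; funext x; ring
      rw [e]
      refine (luxNorm_add_le hp.measurable hp.one_le f.aemeasurable).trans_lt
        (ENNReal.add_lt_top.2 ⟨hf, (luxNorm_const_mul_le hp.one_le _ _).trans_lt
          (ENNReal.mul_lt_top ENNReal.ofReal_lt_top (herr.trans_lt
            (ENNReal.mul_lt_top ENNReal.ofReal_lt_top hmod_top)))⟩)
    · obtain ⟨v, hv, e⟩ := hlow k (by omega)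
      rw [e]
      exact fun x => ((hasDerivAt_avgOp hδ hv x).const_mul _).differentiableAt
    · obtain ⟨v, -, e⟩ := hlow (r - 1) (by omega)
      rw [e]
      exact ((isPrimitive_avgOp_zero hδ v).absolutelyContinuous a b).const_mul _
    · rw [hder]
      exact (LocInt.aemeasurable _).const_mul _
    · have := hder_le.trans_lt (ENNReal.mul_lt_top ENNReal.ofReal_lt_top hmod_top)
      -- A nonzero factor is needed to infer finiteness of the norm from finiteness of the product.
      have h0 : ENNReal.ofReal (δ ^ r) ≠ 0 := by
        rw [ne_eq, ENNReal.ofReal_eq_zero, not_le]; positivity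
      exact lt_top_iff_ne_top.2 fun ht => by
        rw [ht, ENNReal.mul_top h0] at this
        exact lt_irrefl _ this
  rw [hmod]
  refine (iInf₂_le (g : ℝ → ℝ) hgSob).trans ?_
  rw [hfg]
  refine (add_le_add herr hder_le).trans ?_
  rw [← add_mul, ← ENNReal.ofReal_add (by positivity) (by positivity)]
  refine mul_le_mul' (ENNReal.ofReal_le_ofReal ?_) le_rfl
  rw [← mul_pow 2 34, show (2 * 34 : ℝ) = 68 by norm_num]
  have : 0 ≤ D * (2 * r) ^ r := by positivity
  nlinarith

end Converse

/-! ### Comparison with the stated constants -/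

section Constants

variable {p : ℝ → ℝ} {c₁ c₂ : ℝ}

theorem one_le_pPlus (hp : IsPLog p c₁ c₂) : 1 ≤ pPlus p := by
  obtain ⟨M, hM⟩ := hp.essBdd
  have hb : IsBoundedUnder (· ≤ ·) (ae volume) p := ⟨M, by simpa using hM⟩
  have h : ∀ᵐ x, p x ≤ essSup p volume := ae_le_essSup hb
  obtain ⟨x, hx⟩ := h.exists
  exact (hp.one_le x).trans hx

/-- The left side is 800 e^{4c} ≤ 400 `c7`, while `c5` is at least 4 · 3 · 13 because the essential
supremum of p is at least one. -/
theorem avgConst_le (hp : IsPLog p c₁ c₂) :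
    40 * avgConst (max c₁ c₂) ≤ 48 * c7 (max c₁ c₂) * c5 (pPlus p) (max c₁ c₂) := by
  set c := max c₁ c₂
  have hc : 0 ≤ c := hp.pos₁.le.trans (le_max_left _ _)
  set q := pPlus p
  have hq : 1 ≤ q := one_le_pPlus hp
  have h2 : (4 : ℝ) ≤ 2 ^ (q + 1) := by
    calc (4 : ℝ) = 2 ^ (2 : ℝ) := by norm_num
      _ ≤ _ := Real.rpow_le_rpow_of_exponent_le (by norm_num) (by linarith)
  have h3 : (3 : ℝ) ≤ 3 ^ q := by
    calc (3 : ℝ) = 3 ^ (1 : ℝ) := by norm_num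
      _ ≤ _ := Real.rpow_le_rpow_of_exponent_le (by norm_num) hq
  have ht : (0 : ℝ) ≤ ∑' k : ℕ, (1 / 2 : ℝ) ^ (k + 2) := tsum_nonneg fun k => by positivity
  have h4 : (13 : ℝ) ≤ 1 + 2 * (3 : ℝ) ^ q * ((∑' k : ℕ, (1 / 2 : ℝ) ^ (k + 2)) + 2) := by
    nlinarith
  have he8 : (1 : ℝ) ≤ Real.exp (8 * c) := Real.one_le_exp (by positivity)
  have he4 : Real.exp (4 * c) ≤ Real.exp (8 * c) := Real.exp_le_exp.2 (by linarith)
  have h5 : (4 * 3 * 13 * 1 : ℝ) ≤ c5 q c := by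
    unfold c5
    gcongr
  have h6 : 2 * Real.exp (4 * c) ≤ c7 c := by unfold c7; linarith
  calc 40 * avgConst c = 400 * (2 * Real.exp (4 * c)) := by unfold avgConst; ring
    _ ≤ 400 * c7 c := by linarith
    _ ≤ 48 * c7 c * (4 * 3 * 13 * 1) := by
      have : 0 ≤ c7 c := by unfold c7; positivity
      linarith
    _ ≤ _ := by
      have : 0 ≤ c7 c := by unfold c7; positivity
      gcongr

end Constants

end VarExp
end

theorem theorem3p3 (p : ℝ → ℝ) (c₁ c₂ : ℝ) (hp : VarExp.IsPLog p c₁ c₂)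
    (r : ℕ) (hr : 1 ≤ r) (δ : ℝ) (hδ : 0 < δ) (f : ℝ → ℝ) (hf : VarExp.InLp p f) :
    VarExp.modulus p r f δ ≤
        ENNReal.ofReal (48 * VarExp.c7 (max c₁ c₂) * 2 ^ r *
          VarExp.c5 (VarExp.pPlus p) (max c₁ c₂)) *
        VarExp.kFunctional p r f δ ∧
      VarExp.kFunctional p r f δ ≤
        ENNReal.ofReal (48 * VarExp.c7 (max c₁ c₂) *
          ((2 * (r : ℝ)) ^ r + 2 ^ r * 34 ^ r) *
          VarExp.c5 (VarExp.pPlus p) (max c₁ c₂)) *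
        VarExp.modulus p r f δ ∧
      VarExp.kFunctional p r f δ < ⊤ ∧ VarExp.modulus p r f δ < ⊤ := by
  have hK := VarExp.kFunctional_lt_top (δ := δ) (r := r) hp hf
  have hft := ((VarExp.inLp_iff hp.one_le).1 hf).2
  -- The operators act on functions themselves, not on classes modulo null sets, so `f` is replaced
  -- by an element with exactly the same values.
  obtain ⟨F, rfl⟩ := VarExp.exists_locInt (hf.locallyIntegrable hp.measurable hp.one_le)
  have h1 := VarExp.modulus_le_kFunctional hp hδ hr F
  have h2 := VarExp.kFunctional_le_modulus hp hδ hr F hft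
  have hc := VarExp.avgConst_le hp
  have hD := VarExp.avgConst_pos (max c₁ c₂)
  refine ⟨h1.trans (mul_le_mul' (ENNReal.ofReal_le_ofReal ?_) le_rfl),
    h2.trans (mul_le_mul' (ENNReal.ofReal_le_ofReal ?_) le_rfl), hK,
    h1.trans_lt (ENNReal.mul_lt_top ENNReal.ofReal_lt_top hK)⟩
  · have h3 := mul_le_mul_of_nonneg_right hc (by positivity : (0 : ℝ) ≤ 2 ^ r)
    have h4 : 0 ≤ VarExp.avgConst (max c₁ c₂) * 2 ^ r := by positivity
    linarith
  · have h3 := mul_le_mul_of_nonneg_right hc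
      (by positivity : (0 : ℝ) ≤ (2 * (r : ℝ)) ^ r + 2 ^ r * 34 ^ r)
    linarith
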